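/- **Setting.** Let $k$ be a perfect field, $X$ a smooth $k$-scheme and $\mathbf D=(D_i)_{i\in I}$ a finite family of distinct integral effective Cartier divisors on $X$ whose union $D=\bigcup_{i\in I} D_i$ is a strict normal crossings divisor. Let $\mathbf r=(r_i)_{i\in I}$ be positive integers, each invertible in $k$, such that for every $i\in I$ the elements $l/r_i\in k$, $0\le l<r_i$, are pairwise distinct (equivalently, $\operatorname{char} k=0$ or $\operatorname{char} k>r_i$ for all $i$). **Logarithmic connections.** $\Omega^1_{X/k}(\log D)$ is the sheaf generated by $\Omega^1_{X/k}$ and symbols $\operatorname{dlog} f$, for $f$ a local equation of some $D_i$, with the relations $f\operatorname{dlog} f=df$ and $\operatorname{dlog}(vf)=\operatorname{dlog} f+v^{-1}dv$ for $v$ a unit. A logarithmic connection on a vector bundle $\mathcal E$ is a $k$-linear map $\nabla:\mathcal E\to\mathcal E\otimes\Omega^1_{X/k}(\log D)$ satisfying the Leibniz rule. Its residue $\operatorname{res}_{D_i}(\nabla):\mathcal E_{|D_i}\to\mathcal E_{|D_i}$ is induced by the map $\Omega^1_{X/k}(\log D)\to\mathcal O_{D_i}$ that kills $\Omega^1_{X/k}$,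 sends $\operatorname{dlog} f$ to $1$ if $f$ is a local equation of $D_i$, and to $0$ if $f$ is a local equation of $D_j$ with $j\ne i$. Let $\mathrm{Con}(X,D)$ be the category of vector bundles with a logarithmic connection, with the morphisms compatible with the connections. **Parabolic connections.** Let $\frac1{\mathbf r}\mathbb Z^I=\prod_{i\in I}\frac1{r_i}\mathbb Z$ with the componentwise order. A parabolic connection with weights in $\frac1{\mathbf r}\mathbb Z^I$ is a functor $(\mathcal E_\cdot,\nabla_\cdot):(\frac1{\mathbf r}\mathbb Z^I)^{op}\to\mathrm{Con}(X,D)$ such that $\mathcal E_\cdot$ is a parabolic bundle: for $\mathbf m\in\mathbb Z^I$ there are pseudo-periodicity isomorphisms $\mathcal E_{\cdot+\mathbf m}\simeq\mathcal E_\cdot\otimes\mathcal O_X(-\sum_i m_iD_i)$ which, for $\mathbf m\ge\mathbf 0$, are compatible with the natural maps of both sides to $\mathcal E_\cdot$ (they are then uniquely determined for $\mathbf m\ge\mathbf 0$; for the other $\mathbf m$ they are obtained from these by inversion). Morphisms of parabolic connections are natural transformations. The parabolic connection is strongly parabolic if for all $\mathbf l\in\mathbb Z^I$ and $i\in I$ the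 endomorphism of $\mathcal E_{\mathbf l/\mathbf r}/\mathcal E_{(\mathbf l+e_i)/\mathbf r}$ induced by $\operatorname{res}_{D_i}(\nabla_{\mathbf l/\mathbf r})$ equals $\frac{l_i}{r_i}\,\mathrm{id}$, where $(e_i)_{i\in I}$ is the canonical basis of $\mathbb Z^I$. **Statement.** Let $(\mathcal E_\cdot,\nabla_\cdot)$ and $(\mathcal E'_\cdot,\nabla'_\cdot)$ be two strongly parabolic connections on $(X,\mathbf D)$ with weights in $\frac1{\mathbf r}\mathbb Z^I$. Then for every isomorphism $\varphi:(\mathcal E_{\mathbf 0},\nabla_{\mathbf 0})\simeq(\mathcal E'_{\mathbf 0},\nabla'_{\mathbf 0})$ in $\mathrm{Con}(X,D)$ there is exactly one isomorphism of parabolic connections $\Phi:(\mathcal E_\cdot,\nabla_\cdot)\simeq(\mathcal E'_\cdot,\nabla'_\cdot)$ with $\Phi_{\mathbf 0}=\varphi$. -/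

import Mathlib

open CategoryTheory AlgebraicGeometry Opposite
open scoped TensorProduct

universe u v

noncomputable section

namespace ParabolicConn

/-! ### Logarithmic differentials of a ring along principal ideals -/

section LogDifferentials

variable (k : Type*) [CommRing k] {A : Type*} [CommRing A] [Algebra k A]
  {B : Type*} [CommRing B] [Algebra k B] {ι : Type*}

/-- The equations of the ideals `I i`: pairs `(i, f)` such that `f` generates `I i`. -/
abbrev Equation (I : ι → Ideal A) := Σ i : ι, {f : A // Ideal.span {f} = I i}

/-- The free `A`-module on the symbols `dlog f`, one for each equation `f` of each `I i`, together
with the Kähler differentials of `A` over `k`. -/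
abbrev LogDiffGen (I : ι → Ideal A) := Ω[A⁄k] × (Equation I →₀ A)

/-- The relations `f · dlog f = df`, for `f` an equation of `I i`, and
`dlog g = dlog f + v⁻¹ dv` for `f` and `g = v f` two equations of `I i`, with `v` a unit. -/
def logDiffRel (I : ι → Ideal A) : Submodule A (LogDiffGen k I) :=
  Submodule.span A
    ({z | ∃ e : Equation I, z = (KaehlerDifferential.D k A e.2.1, - Finsupp.single e e.2.1)} ∪
     {z | ∃ (i : ι) (f g : {f : A // Ideal.span {f} = I i}) (v : Aˣ), g.1 = v * f.1 ∧
        z = (((v⁻¹ : Aˣ) : A) • KaehlerDifferential.D k A v,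
          Finsupp.single ⟨i, f⟩ 1 - Finsupp.single ⟨i, g⟩ 1)})

/-- The module `Ω¹_{A/k}(log)` of differentials of `A` over `k` with logarithmic poles along the
principal ideals `I i`. If `I i = (f i)` with `f i` not a zero divisor, this is the quotient of
`Ω¹_{A/k} ⊕ ⨁ A · dlog (f i)` by the relations `d (f i) = f i · dlog (f i)`, that is, the degree
zero part of the relative differentials of `A[uᵢ, uᵢ⁻¹]` over `k[tᵢ]`, `tᵢ ↦ f i · uᵢ`, with
`dlog (f i) = - d uᵢ / uᵢ`. -/
abbrev LogDiff (I : ι → Ideal A) := LogDiffGen k I ⧸ logDiffRel k I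

/-- The differential `d : A → Ω¹_{A/k}(log)`. -/
def LogDiff.d (I : ι → Ideal A) (a : A) : LogDiff k I :=
  (logDiffRel k I).mkQ (KaehlerDifferential.D k A a, 0)

open Classical in
/-- The residue `Ω¹_{A/k}(log) → A / I i` along `I i`: it kills `Ω¹_{A/k}`, sends `dlog f` to `1`
if `f` is an equation of `I i`, and to `0` if `f` is an equation of `I j`, `j ≠ i`. -/
def LogDiff.residue (I : ι → Ideal A) (i : ι) : LogDiff k I →ₗ[A] A ⧸ I i :=
  (logDiffRel k I).liftQ
    ((Finsupp.linearCombination A fun e : Equation I ↦ if e.1 = i then (1 : A ⧸ I i) else 0) ∘ₗ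
      LinearMap.snd A _ _) (by
    rw [logDiffRel, Submodule.span_le]
    rintro z (⟨⟨j, f, hf⟩, rfl⟩ | ⟨j, f, g, v, -, rfl⟩)
    · by_cases hj : j = i
      · subst hj
        have hz : (Ideal.Quotient.mk (I j)) f = 0 := by
          rw [Ideal.Quotient.eq_zero_iff_mem, ← hf]
          exact Ideal.mem_span_singleton_self f
        simp [Algebra.smul_def, hz]
      · simp [hj]
    · simp)

/-- Functoriality of the Kähler differentials, as a semilinear map. -/
def kaehlerMap (φ : A →ₐ[k] B) : Ω[A⁄k] →ₛₗ[(φ : A →+* B)] Ω[B⁄k] :=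
  letI : Algebra A B := φ.toRingHom.toAlgebra
  haveI : IsScalarTower k A B := IsScalarTower.of_algebraMap_eq fun c ↦ (φ.commutes c).symm
  { toFun := KaehlerDifferential.map k k A B
    map_add' := map_add _
    map_smul' := fun a x ↦ by
      rw [map_smul, ← algebraMap_smul B a]
      rfl }

lemma kaehlerMap_D (φ : A →ₐ[k] B) (a : A) :
    kaehlerMap k φ (KaehlerDifferential.D k A a) = KaehlerDifferential.D k B (φ a) := by
  let : Algebra A B := φ.toRingHom.toAlgebra
  have : IsScalarTower k A B := IsScalarTower.of_algebraMap_eq fun c ↦ (φ.commutes c).symm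
  exact KaehlerDifferential.map_D k k A B a

variable {I : ι → Ideal A} {J : ι → Ideal B}

/-- The image of an equation. -/
def Equation.map (φ : A →ₐ[k] B) (h : ∀ i, (I i).map φ = J i) (e : Equation I) : Equation J :=
  ⟨e.1, φ e.2.1, by
    have h' := congrArg (Ideal.map φ) e.2.2
    rwa [Ideal.map_span, Set.image_singleton, h] at h'⟩

/-- Functoriality of `LogDiffGen`: `dlog f ↦ dlog (φ f)`. -/
def LogDiffGen.map (φ : A →ₐ[k] B) (h : ∀ i, (I i).map φ = J i) :
    LogDiffGen k I →ₛₗ[(φ : A →+* B)] LogDiffGen k J where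
  toFun z := (kaehlerMap k φ z.1,
    Finsupp.mapDomain (Equation.map k φ h) (Finsupp.mapRange φ (map_zero φ) z.2))
  map_add' x y := by
    ext1
    · simp
    · simp [Finsupp.mapRange_add (map_add φ), Finsupp.mapDomain_add]
  map_smul' a x := by
    ext1
    · simp [LinearMap.map_smulₛₗ]
    · have : Finsupp.mapRange φ (map_zero φ) (a • x.2) =
          φ a • Finsupp.mapRange φ (map_zero φ) x.2 := by
        ext; simp
      simp [this, Finsupp.mapDomain_smul]

/-- Functoriality of the logarithmic differentials. -/
def LogDiff.map (φ : A →ₐ[k] B) (h : ∀ i, (I i).map φ = J i) :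
    LogDiff k I →ₛₗ[(φ : A →+* B)] LogDiff k J :=
  (logDiffRel k I).mapQ (logDiffRel k J) (LogDiffGen.map k φ h) (by
    rw [logDiffRel, Submodule.span_le]
    rintro z (⟨e, rfl⟩ | ⟨i, f, g, v, hv, rfl⟩)
    · refine Submodule.subset_span (Or.inl ⟨Equation.map k φ h e, ?_⟩)
      have hn : Finsupp.mapRange φ (map_zero φ) (-(Finsupp.single e e.2.1)) =
          -(Finsupp.single e (φ e.2.1)) := by
        rw [← Finsupp.single_neg, Finsupp.mapRange_single, map_neg, Finsupp.single_neg]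
      ext1
      · exact kaehlerMap_D k φ _
      · change Finsupp.mapDomain _ (Finsupp.mapRange φ _ _) = _
        rw [hn, ← Finsupp.single_neg, Finsupp.mapDomain_single, Finsupp.single_neg]
        rfl
    · refine Submodule.subset_span (Or.inr
        ⟨i, (Equation.map k φ h ⟨i, f⟩).2, (Equation.map k φ h ⟨i, g⟩).2,
          Units.map (φ : A →* B) v, ?_, ?_⟩)
      · change φ g.1 = φ v * φ f.1
        rw [hv, map_mul]
      · ext1
        · change kaehlerMap k φ (_ • _) = _
          rw [LinearMap.map_smulₛₗ, kaehlerMap_D]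
          rfl
        · change Finsupp.mapDomain _ (Finsupp.mapRange φ _ _) = _
          have hn : Finsupp.mapRange φ (map_zero φ)
              (Finsupp.single ⟨i, f⟩ 1 - Finsupp.single ⟨i, g⟩ 1 : Equation I →₀ A) =
              Finsupp.single ⟨i, f⟩ 1 - Finsupp.single ⟨i, g⟩ 1 := by
            rw [Finsupp.mapRange_sub (map_sub φ), Finsupp.mapRange_single,
              Finsupp.mapRange_single, map_one]
          rw [hn, Finsupp.mapDomain_sub, Finsupp.mapDomain_single, Finsupp.mapDomain_single]
          rfl)

end LogDifferentials

/-! ### Sections of sheaves of modules -/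

section Sections

variable {X : Scheme.{u}}

/-- Restriction of functions. -/
abbrev resRing (X : Scheme.{u}) {V U : X.Opens} (h : V ≤ U) : Γ(X, U) →+* Γ(X, V) :=
  (X.presheaf.map (homOfLE h).op).hom

/-- Restriction of sections of a sheaf of modules. -/
def resSec (M : X.Modules) {V U : X.Opens} (h : V ≤ U) : Γ(M, U) →ₛₗ[resRing X h] Γ(M, V) where
  toFun s := M.presheaf.map (homOfLE h).op s
  map_add' := map_add _
  map_smul' r s := Scheme.Modules.map_smul M (homOfLE h) r s

/-- The action of a morphism of sheaves of modules on sections. -/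
def homSec {M N : X.Modules} (φ : M ⟶ N) (U : X.Opens) : Γ(M, U) →ₗ[Γ(X, U)] Γ(N, U) where
  toFun s := φ.app U s
  map_add' := map_add _
  map_smul' r s := Scheme.Modules.Hom.app_smul φ r s

/-- Vector bundles: locally free sheaves of modules of finite rank. Locally on `X` there are
finitely many sections `s 1, …, s n` which form a basis over each smaller open set, that is, define
an isomorphism from `𝒪ⁿ`. -/
def IsVectorBundle (M : X.Modules) : Prop :=
  ∀ x : X, ∃ (U : X.Opens) (_ : x ∈ U) (n : ℕ) (s : Fin n → Γ(M, U)),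
    ∀ (V : X.Opens) (h : V ≤ U),
      LinearIndependent Γ(X, V) (fun j ↦ resSec M h (s j)) ∧
      Submodule.span Γ(X, V) (Set.range fun j ↦ resSec M h (s j)) = ⊤

end Sections

/-! ### Divisors -/

section Divisors

variable {X : Scheme.{u}}

/-- The closed subscheme defined by `D` is an effective Cartier divisor: its ideal is locally
generated by one nonzerodivisor. -/
def IsEffectiveCartier (D : X.IdealSheafData) : Prop :=
  ∀ x : X, ∃ U : X.affineOpens, x ∈ U.1 ∧ ∃ f ∈ nonZeroDivisors Γ(X, U.1), D.ideal U = Ideal.span {f}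

/-- The effective Cartier divisor `D` has strict normal crossings: at every point `x` of `D` the
local ring is regular, and has a regular system of parameters `t 0, …, t (n - 1)` such that `D` has
the equation `t 0 * ⋯ * t (m - 1)` at `x`, for some `1 ≤ m ≤ n`. -/
def IsStrictNormalCrossings (D : X.IdealSheafData) : Prop :=
  IsEffectiveCartier D ∧ ∀ x ∈ D.support,
    IsRegularLocalRing (X.presheaf.stalk x) ∧
    ∃ (n m : ℕ) (t : Fin n → X.presheaf.stalk x),
      (n : WithBot ℕ∞) = ringKrullDim (X.presheaf.stalk x) ∧
      Ideal.span (Set.range t) = IsLocalRing.maximalIdeal (X.presheaf.stalk x) ∧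
      1 ≤ m ∧ m ≤ n ∧
      ∀ (U : X.affineOpens) (hx : x ∈ U.1),
        (D.ideal U).map (X.presheaf.germ U.1 x hx).hom =
          Ideal.span {∏ j ∈ Finset.univ.filter (fun j : Fin n ↦ (j : ℕ) < m), t j}

/-- The log-smooth context: `X` is a smooth scheme over `k` and `(D i)` is a family of distinct
integral effective Cartier divisors whose union has strict normal crossings. -/
structure IsLogSmooth {k : Type u} [Field k] (p : X ⟶ Spec (.of k)) {ι : Type v}
    (D : ι → X.IdealSheafData) : Prop where
  smooth : Smooth p
  cartier : ∀ i, IsEffectiveCartier (D i)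
  integral : ∀ i, IsIntegral (D i).subscheme
  distinct : Function.Injective D
  snc : IsStrictNormalCrossings (⨅ i, D i)

/-- The affine open sets on which every `D i` is principal; if the `D i` are finitely many effective
Cartier divisors, these form a basis of the topology of `X`. -/
abbrev Chart {ι : Type v} (D : ι → X.IdealSheafData) :=
  {U : X.affineOpens // ∀ i, ((D i).ideal U).IsPrincipal}

end Divisors

/-! ### Logarithmic connections -/

section Connections

variable {X : Scheme.{u}} {k : Type u} [Field k] (p : X ⟶ Spec (.of k))
  {ι : Type v} (D : ι → X.IdealSheafData)

/-- The inclusion of the constants. -/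
def scalar (U : X.Opens) : k →+* Γ(X, U) :=
  (resRing X (le_top : U ≤ ⊤)).comp
    ((p.appTop.hom).comp (Scheme.ΓSpecIso (.of k)).inv.hom)

/-- The `k`-algebra structure on the ring of functions. -/
abbrev secAlgebra (U : X.Opens) : Algebra k Γ(X, U) := (scalar p U).toAlgebra

/-- Restriction of functions as a `k`-algebra map. -/
def resAlg {V U : X.Opens} (h : V ≤ U) :
    letI := secAlgebra p U
    letI := secAlgebra p V
    Γ(X, U) →ₐ[k] Γ(X, V) :=
  letI := secAlgebra p U
  letI := secAlgebra p V
  { resRing X h with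
    commutes' := fun c ↦ by
      change (X.presheaf.map _ ≫ X.presheaf.map _) _ = X.presheaf.map _ _
      rw [← Functor.map_comp]
      rfl }

/-- The sections of `Ω¹_{X/k}(log D)` over a chart `U`. -/
abbrev LogForms (U : Chart D) : Type max u v :=
  @LogDiff k _ Γ(X, U.1.1) _ (secAlgebra p U.1.1) ι (fun i ↦ (D i).ideal U.1)

/-- The differential `d : 𝒪_X → Ω¹_{X/k}(log D)` over a chart. -/
def LogForms.d (U : Chart D) (f : Γ(X, U.1.1)) : LogForms p D U :=
  @LogDiff.d k _ Γ(X, U.1.1) _ (secAlgebra p U.1.1) ι _ f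

/-- The residue `Ω¹_{X/k}(log D) → 𝒪_{D i}` over a chart. -/
def LogForms.residue (U : Chart D) (i : ι) :
    LogForms p D U →ₗ[Γ(X, U.1.1)] Γ(X, U.1.1) ⧸ (D i).ideal U.1 :=
  @LogDiff.residue k _ Γ(X, U.1.1) _ (secAlgebra p U.1.1) ι _ i

/-- Restriction of logarithmic differential forms to a smaller chart. -/
def LogForms.res {V U : Chart D} (h : V.1.1 ≤ U.1.1) :
    LogForms p D U →ₛₗ[resRing X h] LogForms p D V :=
  letI := secAlgebra p U.1.1
  letI := secAlgebra p V.1.1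
  LogDiff.map k (resAlg p h) fun i ↦ (D i).map_ideal (U := V.1) (V := U.1) h

variable {p D}

/-- A logarithmic connection `∇ : M → M ⊗ Ω¹_{X/k}(log D)` on a sheaf of modules `M`, given by its
values on the sections over the charts. It is additive and satisfies the Leibniz rule; as `d` kills
`k` it is then `k`-linear. -/
@[ext]
structure LogConnection (p : X ⟶ Spec (.of k)) (D : ι → X.IdealSheafData) (M : X.Modules) where
  nabla (U : Chart D) : Γ(M, U.1.1) →+ Γ(M, U.1.1) ⊗[Γ(X, U.1.1)] LogForms p D U
  leibniz (U : Chart D) (f : Γ(X, U.1.1)) (s : Γ(M, U.1.1)) :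
    nabla U (f • s) = f • nabla U s + s ⊗ₜ LogForms.d p D U f
  restrict {V U : Chart D} (h : V.1.1 ≤ U.1.1) (s : Γ(M, U.1.1)) :
    nabla V (resSec M h s) = TensorProduct.map (resSec M h) (LogForms.res p D h) (nabla U s)

/-- The residue `M → M ⊗ 𝒪_{D i}` of a logarithmic connection along `D i`, over a chart. -/
def LogConnection.residue {M : X.Modules} (c : LogConnection p D M) (U : Chart D) (i : ι)
    (s : Γ(M, U.1.1)) : Γ(M, U.1.1) ⊗[Γ(X, U.1.1)] (Γ(X, U.1.1) ⧸ (D i).ideal U.1) :=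
  (LogForms.residue p D U i).lTensor Γ(M, U.1.1) (c.nabla U s)

variable (p D) in
/-- The objects of the category `Con(X, D)`: vector bundles with a logarithmic connection. -/
structure Con where
  bundle : X.Modules
  isVectorBundle : IsVectorBundle bundle
  conn : LogConnection p D bundle

/-- The morphisms of `Con(X, D)`: morphisms of vector bundles compatible with the connections. -/
@[ext]
structure Con.Hom (E F : Con p D) where
  map : E.bundle ⟶ F.bundle
  compat (U : Chart D) (s : Γ(E.bundle, U.1.1)) :
    F.conn.nabla U (homSec map U.1.1 s) =
      (homSec map U.1.1).rTensor (LogForms p D U) (E.conn.nabla U s)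

/-- The identity of `Con(X, D)`. -/
def Con.Hom.id (E : Con p D) : Con.Hom E E where
  map := 𝟙 _
  compat U s := (LinearMap.rTensor_id_apply (LogForms p D U) Γ(E.bundle, U.1.1)
    (E.conn.nabla U s)).symm

/-- The composition of `Con(X, D)`. -/
def Con.Hom.comp {E F G : Con p D} (f : Con.Hom E F) (g : Con.Hom F G) : Con.Hom E G where
  map := f.map ≫ g.map
  compat U s := by
    refine (g.compat U (homSec f.map U.1.1 s)).trans ?_
    refine (congrArg _ (f.compat U s)).trans ?_
    exact (LinearMap.rTensor_comp_apply (LogForms p D U) (homSec g.map U.1.1)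
      (homSec f.map U.1.1) (E.conn.nabla U s)).symm

instance : Category (Con p D) where
  Hom := Con.Hom
  id := Con.Hom.id
  comp := Con.Hom.comp
  id_comp f := Con.Hom.ext (Category.id_comp f.map)
  comp_id f := Con.Hom.ext (Category.comp_id f.map)
  assoc f g h := Con.Hom.ext (Category.assoc f.map g.map h.map)

variable (p D) in
/-- The functor forgetting the connection. -/
def Con.forget : Con p D ⥤ X.Modules where
  obj E := E.bundle
  map f := f.map

end Connections

/-! ### Parabolic bundles and parabolic connections -/

section Parabolic

variable {X : Scheme.{u}} {k : Type u} [Field k] {p : X ⟶ Spec (.of k)}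
  {ι : Type v} {D : ι → X.IdealSheafData}

/-- The poset `∏ i, (1 / r i) ℤ` of weights. The element `l : ι → ℤ` stands for the weight with
components `l i / r i`; the order is the componentwise one. -/
def Weight (ι : Type v) : Type v := ι → ℤ

instance : PartialOrder (Weight ι) := inferInstanceAs (PartialOrder (ι → ℤ))

instance : Zero (Weight ι) := inferInstanceAs (Zero (ι → ℤ))

/-- The weight `l / r + m`, for an integral multi-index `m ≥ 0`. -/
def Weight.shift (r : ι → ℕ) (l : Weight ι) (m : ι → ℕ) : Weight ι := fun i ↦ l i + r i * m i

lemma Weight.le_shift (r : ι → ℕ) (l : Weight ι) (m : ι → ℕ) : l ≤ l.shift r m :=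
  fun i ↦ le_add_of_nonneg_right (by positivity)

open Classical in
/-- The weight `(l + e_i) / r`, where `e_i` is the `i`-th basis vector. -/
def Weight.next (l : Weight ι) (i : ι) : Weight ι := fun j ↦ l j + if j = i then 1 else 0

lemma Weight.le_next (l : Weight ι) (i : ι) : l ≤ l.next i :=
  fun j ↦ le_add_of_nonneg_right (by split_ifs <;> simp)

/-- A parabolic vector bundle: a functor `E` from the opposite of the poset of weights to vector
bundles such that for every integral multi-index `m ≥ 0` there is a pseudo-periodicity isomorphism
`E_{α + m} ≅ E_α ⊗ 𝒪_X(- ∑ mᵢ Dᵢ)` compatible with the maps of both sides to `E_α`. It is expressed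
on sections over affine open sets. As `E_α ⊗ 𝒪_X(- ∑ mᵢ Dᵢ) → E_α` is injective, this isomorphism is
unique, natural in `α`, compatible with restrictions and with every natural transformation of
functors; the isomorphisms for the other multi-indices are obtained from it by inversion. -/
structure IsParabolicBundle [Fintype ι] (D : ι → X.IdealSheafData) (r : ι → ℕ)
    (E : (Weight ι)ᵒᵖ ⥤ X.Modules) : Prop where
  isVectorBundle (l : Weight ι) : IsVectorBundle (E.obj (op l))
  pseudoPeriodic (l : Weight ι) (m : ι → ℕ) (U : X.affineOpens) :
    ∃ e : Γ(E.obj (op (l.shift r m)), U.1) ≃ₗ[Γ(X, U.1)]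
        Γ(E.obj (op l), U.1) ⊗[Γ(X, U.1)] ((∏ i, D i ^ m i : X.IdealSheafData).ideal U),
      ∀ s, homSec (E.map (homOfLE (l.le_shift r m)).op) U.1 s =
        TensorProduct.rid Γ(X, U.1) _
          ((Submodule.subtype _).lTensor Γ(E.obj (op l), U.1) (e s))

/-- A parabolic connection with weights in `∏ i, (1 / r i) ℤ`: a functor from the opposite of the
poset of weights to `Con(X, D)` whose underlying functor to vector bundles is a parabolic bundle. A
morphism of parabolic connections is a natural transformation of functors to `Con(X, D)`. -/
structure ParabolicConnection [Fintype ι] (p : X ⟶ Spec (.of k)) (D : ι → X.IdealSheafData)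
    (r : ι → ℕ) where
  toFunctor : (Weight ι)ᵒᵖ ⥤ Con p D
  isParabolicBundle : IsParabolicBundle D r (toFunctor ⋙ Con.forget p D)

/-- The category of parabolic connections. -/
instance [Fintype ι] (r : ι → ℕ) : Category (ParabolicConnection p D r) :=
  inferInstanceAs (Category (InducedCategory _ ParabolicConnection.toFunctor))

/-- The evaluation `E_· ↦ E_{l / r}` at a weight. -/
def ParabolicConnection.eval [Fintype ι] (r : ι → ℕ) (l : Weight ι) :
    ParabolicConnection p D r ⥤ Con p D :=
  inducedFunctor ParabolicConnection.toFunctor ⋙ (evaluation _ _).obj (op l)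

/-- The image of `E_{(l + e_i) / r}` in `E_{l / r}`, on sections. -/
def ParabolicConnection.subBundle [Fintype ι] {r : ι → ℕ} (E : ParabolicConnection p D r)
    (l : Weight ι) (i : ι) (U : X.Opens) :
    Submodule Γ(X, U) Γ((E.toFunctor.obj (op l)).bundle, U) :=
  LinearMap.range (homSec (E.toFunctor.map (homOfLE (l.le_next i)).op).map U)

/-- A parabolic connection is strongly parabolic if for all `l` and `i` the endomorphism induced by
the residue of `∇_{l / r}` along `D i` on the quotient `E_{l / r} / E_{(l + e_i) / r}` is the scalar
`l i / r i`. This quotient is killed by the ideal of `D i`, so that it is identified with its tensor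
product with `𝒪_{D i}`. -/
def ParabolicConnection.IsStrong [Fintype ι] {r : ι → ℕ} (E : ParabolicConnection p D r) : Prop :=
  ∀ (l : Weight ι) (i : ι) (U : Chart D) (s : Γ((E.toFunctor.obj (op l)).bundle, U.1.1)),
    ((E.subBundle l i U.1.1).mkQ).rTensor (Γ(X, U.1.1) ⧸ (D i).ideal U.1)
        ((E.toFunctor.obj (op l)).conn.residue U i s) =
      (scalar p U.1.1 ((l i : k) / (r i : k)) • (E.subBundle l i U.1.1).mkQ s) ⊗ₜ 1

end Parabolic

end ParabolicConn

end

/-! Every transition map `E_{l'} → E_l` is injective on affine sections, and on a chart its image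
contains `f · E_l` for some nonzerodivisor `f`, because an integral shift of the weight multiplies
by the ideal of `∑ mᵢ Dᵢ`. Vector bundles are flat, so transition maps are both mono and epi in
`Con(X, D)`. Uniqueness follows: a transformation is determined at weights `≥ 0` by its value at `0`
(mono), then at every weight lying below one of these (epi).

For existence, the heart is a unit step upwards (`exists_next`): a horizontal `ψ : E_l → E'_l`
carries `E_{l+e_i}` into `E'_{l+e_i}`. Filter `E_l` by the `E_{l+n e_i}`, `0 ≤ n ≤ r_i`, and let `Q
= E'_l / E'_{l+e_i}`. The last step is `E_l(-D_i)`, which dies in `Q` since `Q` is killed by the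
ideal of `D_i`. If `E_{w+e_i}` dies in `Q`, then `E_w / E_{w+e_i} → Q` commutes with residues, which
are the scalars `w_i / r_i` and `l_i / r_i`; these differ for `l_i < w_i < l_i + r_i`, so `E_w` dies
too (`residue_step`). Descending from `n = r_i` to `n = 1` gives the claim. Weights that are not `≥
0` are reached from above by dividing by an equation `f` of `∑ mᵢ Dᵢ` (`exists_of_shift`).

Both constructions first give a map of bundles. It is horizontal because equations of the `D_i` are
regular on `Ω¹(log D)` (`LogDiff.isSMulRegular`). This rests on `df ≠ 0` at the generic point of
`D_i`, where smoothness and perfectness of `k` enter. -/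

namespace ParabolicConn

/-! ### Nonvanishing of `df` at the generic point of a divisor -/

section Kaehler

variable {k A : Type*} [Field k] [PerfectField k] [CommRing A] [Algebra k A]
  [Algebra.Smooth k A]

/-- In the local ring at `P` the conormal map from `𝔪/𝔪²` to the differentials over the residue
field is injective, and the class of `f` in `𝔪/𝔪²` is nonzero because `f` is a nonzerodivisor
generating `𝔪`. -/
lemma one_tmul_D_ne_zero {f : A} (hf : f ∈ nonZeroDivisors A) {P : Ideal A} [P.IsPrime]
    (hP : Ideal.span {f} = P) :
    (1 : P.ResidueField) ⊗ₜ[A] KaehlerDifferential.D k A f ≠ 0 := by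
  intro h0
  let R := Localization.AtPrime P
  let K := P.ResidueField
  have hsurj : Function.Surjective (algebraMap R K) := IsLocalRing.residue_surjective
  have : Algebra.EssFiniteType k R := .comp k A R
  have : Algebra.EssFiniteType k K := .comp k R K
  -- The residue field is essentially of finite type over the perfect field `k`, hence formally
  -- smooth; this splits the conormal sequence.
  obtain ⟨l, hl⟩ := (Algebra.FormallySmooth.iff_split_injection (R := k) (P := R) (A := K)
    hsurj).mp inferInstance
  have hinj : Function.Injective (KaehlerDifferential.kerCotangentToTensor k R K) :=
    Function.LeftInverse.injective (g := l) fun x ↦ congr($hl x)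
  have hker : RingHom.ker (algebraMap R K) = Ideal.span {algebraMap A R f} := by
    rw [← Set.image_singleton, ← Ideal.map_span, hP, IsLocalization.AtPrime.map_eq_maximalIdeal P R]
    exact IsLocalRing.ker_residue
  have hmem : algebraMap A R f ∈ RingHom.ker (algebraMap R K) := by
    rw [hker]; exact Ideal.mem_span_singleton_self _
  have h1 : KaehlerDifferential.kerCotangentToTensor k R K
      (Ideal.toCotangent _ ⟨algebraMap A R f, hmem⟩) = 0 := by
    rw [KaehlerDifferential.kerCotangentToTensor_toCotangent]
    let b : K ⊗[A] Ω[A⁄k] →ₗ[A] K ⊗[R] Ω[R⁄k] := TensorProduct.lift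
      (((TensorProduct.mk R K Ω[R⁄k]).restrictScalars₁₂ A A).compl₂
        (KaehlerDifferential.map k k A R))
    have hb : b (1 ⊗ₜ KaehlerDifferential.D k A f) =
        1 ⊗ₜ KaehlerDifferential.D k R (algebraMap A R f) := by
      simp [b]
    rw [← hb, h0, map_zero]
  have h2 := hinj (h1.trans (map_zero _).symm)
  rw [Ideal.toCotangent_eq_zero] at h2
  replace h2 : algebraMap A R f ∈ RingHom.ker (algebraMap R K) ^ 2 := h2
  rw [hker, Ideal.span_singleton_pow] at h2
  obtain ⟨c, hc⟩ := Ideal.mem_span_singleton.mp h2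
  have hreg : algebraMap A R f ∈ nonZeroDivisors R :=
    IsLocalization.map_nonZeroDivisors_le P.primeCompl R ⟨f, hf, rfl⟩
  have hone : 1 - algebraMap A R f * c = 0 := (mem_nonZeroDivisors_iff.mp hreg).1 _ (by
    change algebraMap A R f = _ at hc
    linear_combination hc)
  refine one_ne_zero (α := K) ?_
  rw [← map_one (algebraMap R K), sub_eq_zero.mp hone, map_mul, RingHom.mem_ker.mp hmem, zero_mul]

lemma mem_of_smul_D_mem {f : A} (hf : f ∈ nonZeroDivisors A) {P : Ideal A} [P.IsPrime]
    (hP : Ideal.span {f} = P) {c : A} {ω : Ω[A⁄k]}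
    (h : c • KaehlerDifferential.D k A f = f • ω) : c ∈ P := by
  have h1 : algebraMap A P.ResidueField c • ((1 : P.ResidueField) ⊗ₜ[A] KaehlerDifferential.D k A f)
      = 0 := by
    rw [algebraMap_smul, ← TensorProduct.tmul_smul, h, TensorProduct.tmul_smul,
      TensorProduct.smul_tmul', Algebra.smul_def, mul_one,
      Ideal.algebraMap_residueField_eq_zero.mpr (hP ▸ Ideal.mem_span_singleton_self f),
      TensorProduct.zero_tmul]
  exact Ideal.algebraMap_residueField_eq_zero.mp
    ((smul_eq_zero.mp h1).resolve_right (one_tmul_D_ne_zero hf hP))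

end Kaehler

/-! ### Local equations are regular on logarithmic differentials -/

section LogDiff

variable {k A : Type*} [Field k] [CommRing A] [Algebra k A]
  {ι : Type*} {I : ι → Ideal A} {f : ι → A}

lemma exists_unit_of_span_eq {A : Type*} [CommRing A] {f g : A} (hf : f ∈ nonZeroDivisors A)
    (h : Ideal.span {g} = Ideal.span {f}) : ∃ v : Aˣ, g = v * f := by
  obtain ⟨a, ha⟩ := Ideal.mem_span_singleton.mp (h ▸ Ideal.mem_span_singleton_self g)
  obtain ⟨b, hb⟩ := Ideal.mem_span_singleton.mp (h.symm ▸ Ideal.mem_span_singleton_self f)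
  have hab : a * b = 1 := by
    have : (a * b - 1) * f = 0 := by linear_combination b * ha.symm - hb
    exact sub_eq_zero.mp ((mem_nonZeroDivisors_iff.mp hf).2 _ this)
  exact ⟨⟨a, b, hab, by rw [mul_comm, hab]⟩, by rw [ha, mul_comm]⟩

/-- The logarithmic derivative of a unit. -/
noncomputable def dlogUnit (k : Type*) {A : Type*} [CommRing k] [CommRing A] [Algebra k A] (v : Aˣ) :
    Ω[A⁄k] :=
  ((v⁻¹ : Aˣ) : A) • KaehlerDifferential.D k A v

lemma dlogUnit_mul (v w : Aˣ) : dlogUnit k (v * w) = dlogUnit k v + dlogUnit k w := by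
  simp only [dlogUnit, Units.val_mul, Derivation.leibniz, smul_add, smul_smul, mul_inv]
  rw [add_comm]
  congr 2
  · simp [mul_assoc]
  · rw [mul_right_comm]
    simp

/-- With one equation `f i` fixed for each `i`, the module is `Ω ⊕ A^(ι)` modulo the vectors `(d f
i, -f i · e i)`. If `f j · y = ∑ c i · gen i`, then `f j` divides every `c i`: for `i ≠ j` by
primality of `I j`, for `i = j` by nonvanishing of `d f j`. Cancelling `f j` in the flat module `Ω ⊕
A^(ι)` puts `y` in the span. -/
theorem LogDiff.isSMulRegular [PerfectField k] [Algebra.Smooth k A] (hI : ∀ i, Ideal.span {f i} = I i)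
    (hf : ∀ i, f i ∈ nonZeroDivisors A) (hp : ∀ i, I i = ⊤ ∨ (I i).IsPrime)
    (hne : ∀ i j, i ≠ j → I j ≠ ⊤ → f i ∉ I j) (j : ι) :
    IsSMulRegular (LogDiff k I) (f j) := by
  classical
  by_cases hj : I j = ⊤
  · exact IsUnit.isSMulRegular _ (Ideal.span_singleton_eq_top.mp ((hI j).trans hj))
  have := (hp j).resolve_left hj
  choose v hv using fun e : Equation I ↦
    exists_unit_of_span_eq (hf e.1) (e.2.2.trans (hI e.1).symm)
  -- `ρ` rewrites `dlog (v f)` as `dlog f + v⁻¹ dv`, and `σ` includes the chosen symbols. Both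
  -- respect the relations and `σ ∘ ρ` is the identity modulo them, so the question reduces to the
  -- small presentation.
  let ρ : LogDiffGen k I →ₗ[A] Ω[A⁄k] × (ι →₀ A) := (LinearMap.inl A _ _).coprod
    (Finsupp.linearCombination A fun e ↦ (dlogUnit k (v e), Finsupp.single e.1 1))
  let σ : Ω[A⁄k] × (ι →₀ A) →ₗ[A] LogDiffGen k I := (LinearMap.inl A _ _).coprod
    (Finsupp.linearCombination A fun i ↦ (0, Finsupp.single ⟨i, f i, hI i⟩ 1))
  let gen (i : ι) : Ω[A⁄k] × (ι →₀ A) := (KaehlerDifferential.D k A (f i), -Finsupp.single i (f i))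
  have hρ : logDiffRel k I ≤ (Submodule.span A (Set.range gen)).comap ρ := by
    rw [logDiffRel, Submodule.span_le]
    rintro z (⟨e, rfl⟩ | ⟨i, f', g, w, hw, rfl⟩)
    · have hD : KaehlerDifferential.D k A e.2.1 = ((v e : Aˣ) : A) • KaehlerDifferential.D k A (f e.1)
          + e.2.1 • dlogUnit k (v e) := by
        conv_lhs => rw [hv e]
        rw [Derivation.leibniz, dlogUnit, smul_smul]
        conv_rhs => rw [hv e]
        rw [mul_right_comm, Units.mul_inv, one_mul]
      have : ρ (KaehlerDifferential.D k A e.2.1, -Finsupp.single e e.2.1) =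
          ((v e : Aˣ) : A) • gen e.1 := by
        ext1
        · simp [ρ, gen, hD]
        · simp [ρ, gen, ← hv e]
      rw [SetLike.mem_coe, Submodule.mem_comap, this]
      exact Submodule.smul_mem _ _ (Submodule.subset_span ⟨_, rfl⟩)
    · have hvw : v ⟨i, g⟩ = w * v ⟨i, f'⟩ := by
        refine Units.ext (sub_eq_zero.mp ((mem_nonZeroDivisors_iff.mp (hf i)).2 _ ?_))
        have h1 := hv ⟨i, g⟩
        have h2 := hv ⟨i, f'⟩
        simp only at h1 h2
        rw [hw, h2] at h1
        rw [Units.val_mul]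
        linear_combination -h1
      have : ρ (((w⁻¹ : Aˣ) : A) • KaehlerDifferential.D k A w,
          Finsupp.single ⟨i, f'⟩ 1 - Finsupp.single ⟨i, g⟩ 1) = 0 := by
        ext1
        · simp [ρ, hvw, dlogUnit_mul]
          simp [dlogUnit]
        · simp [ρ]
      rw [SetLike.mem_coe, Submodule.mem_comap, this]
      exact zero_mem _
  have hσ : Submodule.span A (Set.range gen) ≤ (logDiffRel k I).comap σ := by
    rw [Submodule.span_le]
    rintro _ ⟨i, rfl⟩
    refine Submodule.subset_span (Or.inl ⟨⟨i, f i, hI i⟩, ?_⟩)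
    simp [σ, gen]
  have hσρ (x : LogDiffGen k I) : x - σ (ρ x) ∈ logDiffRel k I := by
    obtain ⟨ω, a⟩ := x
    induction a using Finsupp.induction_linear generalizing ω with
    | zero => simp [ρ, σ]
    | add a b ha hb =>
      have h := add_mem (ha ω) (hb 0)
      rwa [sub_add_sub_comm, ← map_add, ← map_add, Prod.mk_add_mk, add_zero] at h
    | single e c =>
      have h1 : ((v e : Aˣ) : A) * f e.1 = e.2.1 := (hv e).symm
      have h2 := neg_mem (Submodule.smul_mem (logDiffRel k I) c (Submodule.subset_span
        (Or.inr ⟨e.1, ⟨f e.1, hI e.1⟩, e.2, v e, hv e, rfl⟩)))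
      convert h2 using 1
      ext1
      · simp [ρ, σ, dlogUnit]
      · simp [ρ, σ, smul_sub]
  have key (y : Ω[A⁄k] × (ι →₀ A)) (hy : f j • y ∈ Submodule.span A (Set.range gen)) :
      y ∈ Submodule.span A (Set.range gen) := by
    obtain ⟨c, hc⟩ := Finsupp.mem_span_range_iff_exists_finsupp.mp hy
    have hc2 (i : ι) : f j * y.2 i = -(c i * f i) := by
      have := congr(($hc).2 i)
      simp only [Finsupp.sum, gen, Prod.snd_sum, Finsupp.finsetSum_apply] at this
      rw [Finset.sum_eq_single i] at this
      · simpa using this.symm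
      · intro b _ hb; simp [Finsupp.single_eq_of_ne' hb]
      · intro hi; simp [Finsupp.notMem_support_iff.mp hi]
    have hcj (i : ι) (hi : i ≠ j) : f j ∣ c i := by
      rw [← Ideal.mem_span_singleton, hI j]
      refine (this.mem_or_mem (x := c i) (y := f i) ?_).resolve_right (hne i j hi hj)
      rw [← hI j, Ideal.mem_span_singleton]
      exact ⟨-y.2 i, by linear_combination hc2 i⟩
    -- The terms with `i ≠ j` are already divisible by `f j`, so the first component leaves only `c
    -- j · d f j` to account for.
    have hsum : ∃ ω : Ω[A⁄k], c j • KaehlerDifferential.D k A (f j) = f j • ω := by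
      have h1 : ∑ i ∈ c.support, c i • KaehlerDifferential.D k A (f i) = f j • y.1 := by
        simpa [Finsupp.sum, gen, Prod.fst_sum] using congr(($hc).1)
      have h2 : c j • KaehlerDifferential.D k A (f j) = f j • y.1 -
          ∑ i ∈ c.support.erase j, c i • KaehlerDifferential.D k A (f i) := by
        rw [← h1, eq_sub_iff_add_eq]
        by_cases hjc : j ∈ c.support
        · exact Finset.add_sum_erase _ (fun i ↦ c i • KaehlerDifferential.D k A (f i)) hjc
        · rw [Finset.erase_eq_of_notMem hjc, Finsupp.notMem_support_iff.mp hjc, zero_smul, zero_add]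
      have h3 : ∑ i ∈ c.support.erase j, c i • KaehlerDifferential.D k A (f i) ∈
          LinearMap.range (LinearMap.lsmul A Ω[A⁄k] (f j)) := by
        refine Submodule.sum_mem _ fun i hi ↦ ?_
        obtain ⟨b, hb⟩ := hcj i (Finset.ne_of_mem_erase hi)
        exact ⟨b • KaehlerDifferential.D k A (f i), by simp [hb, smul_smul, mul_comm]⟩
      obtain ⟨ω, hω⟩ := h3
      exact ⟨y.1 - ω, by rw [h2, ← hω, smul_sub]; rfl⟩
    obtain ⟨ω, hω⟩ := hsum
    have hdvd (i : ι) : f j ∣ c i := by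
      by_cases hi : i = j
      · subst hi
        rw [← Ideal.mem_span_singleton, hI i]
        exact mem_of_smul_D_mem (hf i) (hI i) hω
      · exact hcj i hi
    choose b hb using hdvd
    have hreg : IsSMulRegular (Ω[A⁄k] × (ι →₀ A)) (f j) := by
      rw [Prod.isSMulRegular_iff]
      exact ⟨Module.Flat.isSMulRegular_of_nonZeroDivisors (hf j),
        Module.Flat.isSMulRegular_of_nonZeroDivisors (hf j)⟩
    have : y = ∑ i ∈ c.support, b i • gen i := hreg (by
      simp only [← hc, Finsupp.sum, Finset.smul_sum, smul_smul, ← hb])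
    rw [this]
    exact Submodule.sum_mem _ fun i _ ↦ Submodule.smul_mem _ _ (Submodule.subset_span ⟨i, rfl⟩)
  refine IsSMulRegular.of_right_eq_zero_of_smul fun x hx ↦ ?_
  obtain ⟨x, rfl⟩ := Submodule.mkQ_surjective _ x
  rw [← map_smul, Submodule.mkQ_apply, Submodule.Quotient.mk_eq_zero] at hx
  rw [Submodule.mkQ_apply, Submodule.Quotient.mk_eq_zero]
  have h1 := hσ (key (ρ x) (by rw [← map_smul]; exact hρ hx))
  simpa using add_mem (hσρ x) h1

end LogDiff

/-! ### Charts, integral divisors and their local equations -/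

section DivisorLemmas

variable {X : Scheme.{u}}

lemma resRing_flat {U V : X.Opens} (hU : IsAffineOpen U) (hV : IsAffineOpen V) (h : V ≤ U) :
    (resRing X h).Flat := by
  have := Scheme.Hom.flat_appLE (𝟙 X) hU hV h
  have h2 : (𝟙 X : X ⟶ X).appLE U V h = X.presheaf.map (homOfLE h).op := by
    simp only [Scheme.Hom.appLE, Scheme.Hom.id_app]
    exact Category.id_comp _
  rwa [h2] at this

lemma resRing_mem_nonZeroDivisors {U V : X.Opens} (hU : IsAffineOpen U) (hV : IsAffineOpen V)
    (h : V ≤ U) {f : Γ(X, U)} (hf : f ∈ nonZeroDivisors Γ(X, U)) :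
    resRing X h f ∈ nonZeroDivisors Γ(X, V) := by
  let : Algebra Γ(X, U) Γ(X, V) := (resRing X h).toAlgebra
  have : Module.Flat Γ(X, U) Γ(X, V) := resRing_flat hU hV h
  have hr : IsSMulRegular Γ(X, V) f := Module.Flat.isSMulRegular_of_nonZeroDivisors hf
  rw [mem_nonZeroDivisors_iff_right]
  intro a ha
  exact hr.right_eq_zero_of_smul (by rw [Algebra.smul_def, mul_comm]; exact ha)

lemma resRing_eq_zero_of_forall {U : X.Opens} {a : Γ(X, U)}
    (h : ∀ x ∈ U, ∃ (V : X.Opens) (hV : V ≤ U), x ∈ V ∧ resRing X hV a = 0) : a = 0 := by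
  choose V hV hx h0 using fun x : U ↦ h x.1 x.2
  refine X.sheaf.eq_of_locally_eq' V U (fun x ↦ homOfLE (hV x))
    (fun x hxU ↦ TopologicalSpace.Opens.mem_iSup.mpr ⟨⟨x, hxU⟩, hx ⟨x, hxU⟩⟩) a 0 fun x ↦ ?_
  rw [map_zero]
  exact h0 x

variable {ι : Type v} {D : ι → X.IdealSheafData}

lemma map_ideal_resRing (I : X.IdealSheafData) {U V : X.affineOpens} (h : V.1 ≤ U.1) :
    (I.ideal U).map (resRing X h) = I.ideal V :=
  I.map_ideal h

lemma isPrincipal_ideal_of_le {I : X.IdealSheafData} {U V : X.affineOpens} (h : V.1 ≤ U.1)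
    (hU : (I.ideal U).IsPrincipal) : (I.ideal V).IsPrincipal := by
  obtain ⟨f, hf⟩ := hU
  rw [← map_ideal_resRing I h, hf, Ideal.submodule_span_eq, Ideal.map_span,
    Set.image_singleton]
  exact ⟨_, rfl⟩

lemma exists_chart [Finite ι] (hD : ∀ i, IsEffectiveCartier (D i)) {x : X} {W : X.Opens}
    (hx : x ∈ W) : ∃ V : Chart D, x ∈ V.1.1 ∧ V.1.1 ≤ W := by
  choose U hxU f hf hU using fun i ↦ hD i x
  have hopen : IsOpen ((⋂ i, ((U i).1 : Set X)) ∩ W) :=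
    (isOpen_iInter_of_finite fun i ↦ (U i).1.isOpen).inter W.isOpen
  obtain ⟨_, ⟨V, hVaff, rfl⟩, hxV, hV⟩ := X.isBasis_affineOpens.exists_subset_of_mem_open
    (show x ∈ (⋂ i, ((U i).1 : Set X)) ∩ W from ⟨Set.mem_iInter.mpr hxU, hx⟩) hopen
  exact ⟨⟨⟨V, hVaff⟩, fun i ↦ isPrincipal_ideal_of_le (U := U i)
    (fun y hy ↦ Set.mem_iInter.mp (hV hy).1 i) ⟨f i, hU i⟩⟩, hxV, fun y hy ↦ (hV hy).2⟩

/-- The Cartier condition supplies regular equations only near each point. On a common smaller chart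
any generator differs from such an equation by a unit, and restriction to affine opens preserves
regularity by flatness. -/
lemma mem_nonZeroDivisors_of_span_eq [Finite ι] (hD : ∀ i, IsEffectiveCartier (D i)) {i : ι}
    {U : X.affineOpens} {f : Γ(X, U.1)} (hf : Ideal.span {f} = (D i).ideal U) :
    f ∈ nonZeroDivisors Γ(X, U.1) := by
  rw [mem_nonZeroDivisors_iff_right]
  intro a ha
  refine resRing_eq_zero_of_forall fun x hx ↦ ?_
  obtain ⟨W, hxW, g, hg, hW⟩ := hD i x
  obtain ⟨V, hxV, hV⟩ := exists_chart hD (W := U.1 ⊓ W.1) ⟨hx, hxW⟩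
  have hVU := hV.trans inf_le_left
  have hVW := hV.trans inf_le_right
  refine ⟨V.1.1, hVU, hxV, ?_⟩
  have h1 : Ideal.span {resRing X hVU f} = Ideal.span {resRing X hVW g} := by
    rw [← Set.image_singleton, ← Ideal.map_span, hf, map_ideal_resRing (D i) hVU,
      ← map_ideal_resRing (D i) hVW, hW, Ideal.map_span, Set.image_singleton]
  have hg' := resRing_mem_nonZeroDivisors W.2 V.1.2 hVW hg
  obtain ⟨v, hv⟩ := exists_unit_of_span_eq hg' h1
  have h2 : resRing X hVU f ∈ nonZeroDivisors Γ(X, V.1.1) := by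
    rw [hv]; exact mul_mem v.isUnit.mem_nonZeroDivisors hg'
  refine (mem_nonZeroDivisors_iff.mp h2).2 _ ?_
  rw [← map_mul, ha, map_zero]

lemma nonempty_preimage_of_ideal_ne_top {I : X.IdealSheafData} {U : X.affineOpens}
    (h : I.ideal U ≠ ⊤) : Nonempty (I.subschemeι ⁻¹ᵁ U.1) := by
  by_contra h'
  rw [not_nonempty_iff] at h'
  refine h ?_
  have h2 : I.subschemeι ⁻¹ᵁ U.1 = ⊥ := by
    ext y
    exact ⟨fun hy ↦ (h'.false ⟨y, hy⟩).elim, fun hy ↦ hy.elim⟩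
  have : Subsingleton Γ(I.subscheme, I.subschemeι ⁻¹ᵁ U.1) := by
    rw [h2]; infer_instance
  rw [← I.ker_subschemeι_app U, Ideal.eq_top_iff_one, RingHom.mem_ker]
  exact Subsingleton.elim _ _

lemma ideal_eq_top_or_isPrime {I : X.IdealSheafData} [IsIntegral I.subscheme] (U : X.affineOpens) :
    I.ideal U = ⊤ ∨ (I.ideal U).IsPrime := by
  refine or_iff_not_imp_left.mpr fun h ↦ ?_
  have := nonempty_preimage_of_ideal_ne_top h
  rw [← I.ker_subschemeι_app U]
  exact RingHom.ker_isPrime _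

lemma IdealSheafData.radical_eq_self {I : X.IdealSheafData} [IsIntegral I.subscheme] :
    I.radical = I := by
  ext U : 2
  rw [Scheme.IdealSheafData.radical_ideal]
  obtain h | h := ideal_eq_top_or_isPrime (I := I) U
  · rw [h, Ideal.radical_top]
  · exact h.radical

lemma isIrreducible_support {I : X.IdealSheafData} [IsIntegral I.subscheme] :
    IsIrreducible (I.support : Set X) := by
  rw [← I.range_subschemeι, ← Set.image_univ]
  exact (IrreducibleSpace.isIrreducible_univ _).image _ I.subschemeι.continuous.continuousOn

lemma support_subset_of_ideal_eq {I J : X.IdealSheafData} [IsIntegral I.subscheme]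
    {U : X.affineOpens} (h : I.ideal U = J.ideal U) (hI : I.ideal U ≠ ⊤) :
    (I.support : Set X) ⊆ J.support := by
  have h1 : (I.support : Set X) ∩ U.1 = (J.support : Set X) ∩ U.1 := by
    rw [I.coe_support_inter, J.coe_support_inter, h]
  have hne : ((I.support : Set X) ∩ U.1).Nonempty := by
    obtain ⟨y, hy⟩ := nonempty_preimage_of_ideal_ne_top hI
    exact ⟨I.subschemeι y, I.range_subschemeι ▸ ⟨y, rfl⟩, hy⟩
  refine (subset_closure_inter_of_isPreirreducible_of_isOpen
    isIrreducible_support.isPreirreducible U.1.isOpen hne).trans ?_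
  rw [h1]
  exact closure_minimal Set.inter_subset_left J.support.isClosed

/-- An irreducible closed set is the closure of its nonempty trace on `U`, so the supports agree; an
integral closed subscheme has radical ideal and is recovered from its support. -/
lemma eq_of_ideal_eq {I J : X.IdealSheafData} [IsIntegral I.subscheme] [IsIntegral J.subscheme]
    {U : X.affineOpens} (h : I.ideal U = J.ideal U) (hI : I.ideal U ≠ ⊤) : I = J := by
  have : I.support = J.support := TopologicalSpace.Closeds.ext
    ((support_subset_of_ideal_eq h hI).antisymm (support_subset_of_ideal_eq h.symm (h ▸ hI)))
  rw [← IdealSheafData.radical_eq_self (I := I), ← IdealSheafData.radical_eq_self (I := J),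
    ← Scheme.IdealSheafData.vanishingIdeal_support, this,
    Scheme.IdealSheafData.vanishingIdeal_support]

variable {k : Type u} [Field k] {p : X ⟶ Spec (.of k)}

lemma smooth_secAlgebra (hp : Smooth p) (U : X.affineOpens) :
    letI := secAlgebra p U.1
    Algebra.Smooth k Γ(X, U.1) := by
  have h := Scheme.Hom.smooth_appLE p (isAffineOpen_top _) U.2 le_top
  have h2 : (scalar p U.1).Smooth :=
    (RingHom.Smooth.comp (f := (Scheme.ΓSpecIso (.of k)).inv.hom)
      (.of_bijective (Scheme.ΓSpecIso (.of k)).symm.commRingCatIsoToRingEquiv.bijective) h :)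
  exact h2

lemma IsLogSmooth.mem_nonZeroDivisors [Finite ι] (hD : IsLogSmooth p D) {i : ι} {U : X.affineOpens}
    {f : Γ(X, U.1)} (hf : Ideal.span {f} = (D i).ideal U) : f ∈ nonZeroDivisors Γ(X, U.1) :=
  mem_nonZeroDivisors_of_span_eq hD.cartier hf

theorem IsLogSmooth.isSMulRegular [PerfectField k] [Finite ι] (hD : IsLogSmooth p D) (U : Chart D)
    {i : ι} {f : Γ(X, U.1.1)} (hf : Ideal.span {f} = (D i).ideal U.1) :
    IsSMulRegular (LogForms p D U) f := by
  let := secAlgebra p U.1.1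
  have := smooth_secAlgebra hD.smooth U.1
  have := hD.integral
  obtain ⟨g, hg⟩ : ∃ g : ι → Γ(X, U.1.1), ∀ j, Ideal.span {g j} = (D j).ideal U.1 ∧
      (j = i → g j = f) := by
    classical
    choose g hg using fun j ↦ (U.2 j).principal
    refine ⟨fun j ↦ if j = i then f else g j, fun j ↦ ⟨?_, fun h ↦ if_pos h⟩⟩
    dsimp only
    split_ifs with h
    · rw [hf, h]
    · exact (hg j).symm
  rw [← (hg i).2 rfl]
  refine LogDiff.isSMulRegular (fun j ↦ (hg j).1) (fun j ↦ hD.mem_nonZeroDivisors (hg j).1)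
    (fun j ↦ ideal_eq_top_or_isPrime U.1) (fun a b hab hb hmem ↦ ?_) i
  have hle : (D a).ideal U.1 ≤ (D b).ideal U.1 := by
    rw [← (hg a).1, Ideal.span_singleton_le_iff_mem]; exact hmem
  have ha : (D a).ideal U.1 ≠ ⊤ := fun h ↦ hb (top_le_iff.mp (h ▸ hle))
  have hpa := (ideal_eq_top_or_isPrime (I := D a) U.1).resolve_left ha
  have hpb := (ideal_eq_top_or_isPrime (I := D b) U.1).resolve_left hb
  obtain ⟨c, hc⟩ := Ideal.mem_span_singleton.mp ((hg b).1.symm ▸ hmem)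
  refine hab (hD.distinct (eq_of_ideal_eq (U := U.1) (hle.antisymm ?_) ha))
  have hga : g a ∈ (D a).ideal U.1 := (hg a).1 ▸ Ideal.mem_span_singleton_self _
  -- From `g a = g b * c` with `(g a)` prime: either `g b ∈ (g a)`, so that the two divisors
  -- coincide, or `c ∈ (g a)`, so that `g b` is a unit.
  obtain h1 | h1 := hpa.mem_or_mem (hc ▸ hga)
  · rwa [← (hg b).1, Ideal.span_singleton_le_iff_mem]
  · exfalso
    rw [← (hg a).1] at h1
    obtain ⟨e, he⟩ := Ideal.mem_span_singleton.mp h1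
    refine hb ((hg b).1.symm.trans (Ideal.span_singleton_eq_top.mpr (.of_mul_eq_one e ?_)))
    have : (g b * e - 1) * g a = 0 := by
      linear_combination g b * he.symm - hc
    exact sub_eq_zero.mp ((mem_nonZeroDivisors_iff.mp (hD.mem_nonZeroDivisors (hg a).1)).2 _ this)

end DivisorLemmas

/-! ### Restriction and gluing of sections -/

section SectionLemmas

variable {X : Scheme.{u}} {M : X.Modules}

lemma resRing_resRing {U V W : X.Opens} (h : V ≤ U) (h' : W ≤ V) (f : Γ(X, U)) :
    resRing X h' (resRing X h f) = resRing X (h'.trans h) f := by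
  change (X.presheaf.map _ ≫ X.presheaf.map _) f = X.presheaf.map _ f
  rw [← Functor.map_comp]
  rfl

lemma resSec_resSec {U V W : X.Opens} (h : V ≤ U) (h' : W ≤ V) (s : Γ(M, U)) :
    resSec M h' (resSec M h s) = resSec M (h'.trans h) s := by
  change (M.presheaf.map _ ≫ M.presheaf.map _) s = M.presheaf.map _ s
  rw [← Functor.map_comp]
  rfl

lemma resSec_self {U : X.Opens} (s : Γ(M, U)) : resSec M le_rfl s = s := by
  change M.presheaf.map (𝟙 _) s = s
  rw [M.presheaf.map_id]
  rfl

lemma resSec_smul {U V : X.Opens} (h : V ≤ U) (f : Γ(X, U)) (s : Γ(M, U)) :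
    resSec M h (f • s) = resRing X h f • resSec M h s :=
  LinearMap.map_smulₛₗ _ _ _

lemma homSec_resSec {N : X.Modules} (φ : M ⟶ N) {U V : X.Opens} (h : V ≤ U) (s : Γ(M, U)) :
    homSec φ V (resSec M h s) = resSec N h (homSec φ U s) :=
  congr($(φ.mapPresheaf.naturality (homOfLE h).op) s)

lemma section_ext {U : X.Opens} {s t : Γ(M, U)}
    (h : ∀ x ∈ U, ∃ (V : X.Opens) (hV : V ≤ U), x ∈ V ∧ resSec M hV s = resSec M hV t) : s = t := by
  choose V hV hx h0 using fun x : U ↦ h x.1 x.2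
  exact TopCat.Sheaf.eq_of_locally_eq' ⟨M.presheaf, M.isSheaf⟩ V U (fun x ↦ homOfLE (hV x))
    (fun x hxU ↦ TopologicalSpace.Opens.mem_iSup.mpr ⟨⟨x, hxU⟩, hx ⟨x, hxU⟩⟩) s t h0

lemma exists_section_glue {κ : Type u} {U : X.Opens} {V : κ → X.Opens} (hV : ∀ i, V i ≤ U)
    (hU : U ≤ ⨆ i, V i) (s : ∀ i, Γ(M, V i))
    (h : ∀ i j, resSec M (inf_le_left : V i ⊓ V j ≤ V i) (s i) =
      resSec M (inf_le_right : V i ⊓ V j ≤ V j) (s j)) :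
    ∃ t : Γ(M, U), ∀ i, resSec M (hV i) t = s i :=
  (TopCat.Sheaf.existsUnique_gluing' ⟨M.presheaf, M.isSheaf⟩ V U (fun i ↦ homOfLE (hV i)) hU s
    fun i j ↦ h i j).exists

end SectionLemmas

/-! ### Flatness of vector bundles over affine opens -/

section Flat

variable {X : Scheme.{u}} {M : X.Modules}

/-- The restriction of a sheaf of modules to an open set is free of finite rank. -/
def IsFreeOn (M : X.Modules) (U : X.Opens) : Prop :=
  ∃ (n : ℕ) (s : Fin n → Γ(M, U)), ∀ (V : X.Opens) (h : V ≤ U),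
    LinearIndependent Γ(X, V) (fun j ↦ resSec M h (s j)) ∧
    Submodule.span Γ(X, V) (Set.range fun j ↦ resSec M h (s j)) = ⊤

lemma IsFreeOn.of_le {U V : X.Opens} (h : IsFreeOn M U) (hV : V ≤ U) : IsFreeOn M V := by
  obtain ⟨n, s, hs⟩ := h
  refine ⟨n, fun j ↦ resSec M hV (s j), fun W hW ↦ ?_⟩
  simp only [resSec_resSec]
  exact hs W (hW.trans hV)

lemma IsFreeOn.free {U : X.Opens} (h : IsFreeOn M U) : Module.Free Γ(X, U) Γ(M, U) := by
  obtain ⟨n, s, hs⟩ := h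
  obtain ⟨h1, h2⟩ := hs U le_rfl
  exact .of_basis (Module.Basis.mk h1 h2.ge)

lemma IsVectorBundle.exists_isFreeOn (hM : IsVectorBundle M) (x : X) :
    ∃ U : X.Opens, x ∈ U ∧ IsFreeOn M U := by
  obtain ⟨U, hx, n, s, hs⟩ := hM x
  exact ⟨U, hx, n, s, hs⟩

lemma IsFreeOn.exists_pow_smul_eq_zero {U V : X.Opens} (h : IsFreeOn M U) (hU : IsAffineOpen U)
    {f : Γ(X, U)} (hVU : V ≤ U) (hV : V = X.basicOpen f) {t : Γ(M, U)}
    (ht : resSec M hVU t = 0) : ∃ n : ℕ, f ^ n • t = 0 := by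
  obtain ⟨n, s, hs⟩ := h
  let b := Module.Basis.mk (hs U le_rfl).1 (hs U le_rfl).2.ge
  have hb (j) : b j = s j := by simp [b, resSec_self]
  have hloc := hU.isLocalization_of_eq_basicOpen f (homOfLE hVU) hV
  have h0 (j : Fin n) : resRing X hVU (b.repr t j) = 0 := by
    refine Fintype.linearIndependent_iff.mp (hs V hVU).1 (fun j ↦ resRing X hVU (b.repr t j)) ?_ j
    rw [← ht]
    conv_rhs => rw [← b.sum_repr t, map_sum]
    simp [hb]
  have h1 (j : Fin n) : ∃ m : ℕ, f ^ m * b.repr t j = 0 := by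
    let := (resRing X hVU).toAlgebra
    obtain ⟨⟨_, m, rfl⟩, hm⟩ := (IsLocalization.map_eq_zero_iff (.powers f) Γ(X, V) _).mp (h0 j)
    exact ⟨m, hm⟩
  choose m hm using h1
  refine ⟨∑ j, m j, b.repr.injective ?_⟩
  ext j
  rw [map_smul, map_zero, Finsupp.smul_apply, smul_eq_mul, Finset.sum_eq_add_sum_sdiff_singleton_of_mem (Finset.mem_univ j),
    pow_add, mul_right_comm, hm, zero_mul]
  rfl

lemma IsFreeOn.exists_resSec_eq_pow_smul {U V : X.Opens} (h : IsFreeOn M U) (hU : IsAffineOpen U)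
    {f : Γ(X, U)} (hVU : V ≤ U) (hV : V = X.basicOpen f) (s : Γ(M, V)) :
    ∃ (n : ℕ) (t : Γ(M, U)), resSec M hVU t = resRing X hVU (f ^ n) • s := by
  obtain ⟨n, b, hb⟩ := h
  have hloc := hU.isLocalization_of_eq_basicOpen f (homOfLE hVU) hV
  let := (resRing X hVU).toAlgebra
  have hs : s ∈ Submodule.span Γ(X, V) (Set.range fun j ↦ resSec M hVU (b j)) := by
    rw [(hb V hVU).2]; trivial
  obtain ⟨c, rfl⟩ := (Submodule.mem_span_range_iff_exists_fun _).mp hs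
  obtain ⟨⟨_, m, rfl⟩, hm⟩ := IsLocalization.exist_integer_multiples_of_finite (.powers f) c
  choose a ha using hm
  refine ⟨m, ∑ j, a j • b j, ?_⟩
  rw [map_sum, Finset.smul_sum]
  refine Finset.sum_congr rfl fun j _ ↦ ?_
  rw [resSec_smul, smul_smul]
  congr 1
  refine (ha j).trans ?_
  exact Algebra.smul_def _ _

variable {U : X.Opens} {κ : Type u} [Finite κ] {V : κ → X.Opens}

lemma exists_forall_of_monotone {P : κ → ℕ → Prop} (hP : ∀ i m n, m ≤ n → P i m → P i n)
    (h : ∀ i, ∃ n, P i n) : ∃ n, ∀ i, P i n := by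
  choose n hn using h
  obtain ⟨N, hN⟩ := Set.Finite.bddAbove (Set.finite_range n)
  exact ⟨N, fun i ↦ hP i _ _ (hN ⟨i, rfl⟩) (hn i)⟩

lemma le_inf_basicOpen {V : X.Opens} (hV : V ≤ U) (f : Γ(X, U)) :
    V ⊓ X.basicOpen f = X.basicOpen (resRing X hV f) :=
  (X.basicOpen_res f (homOfLE hV).op).symm

lemma exists_pow_smul_eq_zero_of_cover (hV : ∀ i, V i ≤ U) (hU : U ≤ ⨆ i, V i)
    (haff : ∀ i, IsAffineOpen (V i)) (hfree : ∀ i, IsFreeOn M (V i)) {f : Γ(X, U)} {t : Γ(M, U)}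
    (ht : resSec M (X.basicOpen_le f) t = 0) : ∃ n : ℕ, f ^ n • t = 0 := by
  obtain ⟨n, hn⟩ : ∃ n : ℕ, ∀ i, resRing X (hV i) f ^ n • resSec M (hV i) t = 0 := by
    refine exists_forall_of_monotone (fun i m n hmn h ↦ ?_) fun i ↦ ?_
    · rw [← Nat.sub_add_cancel hmn, pow_add, mul_smul, h, smul_zero]
    · refine (hfree i).exists_pow_smul_eq_zero (haff i) (V := V i ⊓ X.basicOpen f) inf_le_left
        (le_inf_basicOpen (hV i) f) ?_
      rw [resSec_resSec, ← resSec_resSec (X.basicOpen_le f) inf_le_right, ht, map_zero]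
  refine ⟨n, section_ext fun x hx ↦ ?_⟩
  obtain ⟨i, hi⟩ := TopologicalSpace.Opens.mem_iSup.mp (hU hx)
  exact ⟨V i, hV i, hi, by rw [resSec_smul, map_pow, hn, map_zero]⟩

/-- Denominators are cleared on each member of a finite trivializing cover, with a uniform exponent,
and the results are glued. -/
lemma exists_resSec_eq_pow_smul_of_cover (hV : ∀ i, V i ≤ U) (hU : U ≤ ⨆ i, V i)
    (haff : ∀ i, IsAffineOpen (V i)) (haff' : ∀ i j, IsAffineOpen (V i ⊓ V j))
    (hfree : ∀ i, IsFreeOn M (V i)) {f : Γ(X, U)} (s : Γ(M, X.basicOpen f)) :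
    ∃ (n : ℕ) (t : Γ(M, U)),
      resSec M (X.basicOpen_le f) t = resRing X (X.basicOpen_le f) (f ^ n) • s := by
  obtain ⟨n, hn⟩ : ∃ n : ℕ, ∀ i, ∃ t : Γ(M, V i), resSec M inf_le_left t =
      resRing X (inf_le_left.trans (hV i)) (f ^ n) •
        resSec M (inf_le_right : V i ⊓ X.basicOpen f ≤ _) s := by
    refine exists_forall_of_monotone (fun i m n hmn h ↦ ?_) fun i ↦ ?_
    · obtain ⟨t, ht⟩ := h
      refine ⟨resRing X (hV i) (f ^ (n - m)) • t, ?_⟩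
      rw [resSec_smul, ht, smul_smul, resRing_resRing, ← map_mul, ← pow_add, Nat.sub_add_cancel hmn]
    · obtain ⟨n, t, ht⟩ := (hfree i).exists_resSec_eq_pow_smul (haff i)
        (V := V i ⊓ X.basicOpen f) inf_le_left (le_inf_basicOpen (hV i) f)
        (resSec M inf_le_right s)
      refine ⟨n, t, ?_⟩
      rw [ht, ← map_pow, resRing_resRing]
  choose t ht using hn
  -- The local extensions `t i` are only known to agree on overlaps after restriction to
  -- `X.basicOpen f`; a further power `f ^ m` makes them agree outright.
  have hVV (i j : κ) : V i ⊓ V j ≤ U := inf_le_left.trans (hV i)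
  obtain ⟨m, hm⟩ : ∃ m : ℕ, ∀ ij : κ × κ, resRing X (hVV ij.1 ij.2) f ^ m •
      (resSec M (inf_le_left : V ij.1 ⊓ V ij.2 ≤ V ij.1) (t ij.1) -
        resSec M (inf_le_right : V ij.1 ⊓ V ij.2 ≤ V ij.2) (t ij.2)) = 0 := by
    refine exists_forall_of_monotone (fun i m n hmn h ↦ ?_) fun ⟨i, j⟩ ↦ ?_
    · rw [← Nat.sub_add_cancel hmn, pow_add, mul_smul, h, smul_zero]
    · refine ((hfree i).of_le inf_le_left).exists_pow_smul_eq_zero (haff' i j)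
        (V := V i ⊓ V j ⊓ X.basicOpen f) inf_le_left (le_inf_basicOpen _ f) ?_
      have h1 : V i ⊓ V j ⊓ X.basicOpen f ≤ V i ⊓ X.basicOpen f := by gcongr; exact inf_le_left
      have h2 : V i ⊓ V j ⊓ X.basicOpen f ≤ V j ⊓ X.basicOpen f := by gcongr; exact inf_le_right
      rw [map_sub, sub_eq_zero, resSec_resSec, resSec_resSec,
        ← resSec_resSec inf_le_left h1, ht, ← resSec_resSec inf_le_left h2, ht, resSec_smul,
        resSec_smul, resSec_resSec, resSec_resSec, resRing_resRing, resRing_resRing]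
  obtain ⟨t', ht'⟩ := exists_section_glue hV hU (fun i ↦ resRing X (hV i) (f ^ m) • t i)
    fun i j ↦ by
      have : _ • (_ - _) = _ := hm (i, j)
      rw [smul_sub, sub_eq_zero] at this
      rw [resSec_smul, resSec_smul, resRing_resRing, resRing_resRing, map_pow]
      exact this
  refine ⟨m + n, t', section_ext fun x hx ↦ ?_⟩
  obtain ⟨i, hi⟩ := TopologicalSpace.Opens.mem_iSup.mp (hU (X.basicOpen_le f hx))
  refine ⟨V i ⊓ X.basicOpen f, inf_le_right, ⟨hi, hx⟩, ?_⟩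
  rw [resSec_resSec, ← resSec_resSec (hV i) inf_le_left, ht', resSec_smul, ht, resSec_smul,
    smul_smul, resRing_resRing, resRing_resRing, ← map_mul, ← pow_add]

/-- The sections of a vector bundle over an affine open set form a flat module. -/
theorem IsVectorBundle.flat (hM : IsVectorBundle M) (hU : IsAffineOpen U) :
    Module.Flat Γ(X, U) Γ(M, U) := by
  have hcov : Ideal.span {g : Γ(X, U) | IsFreeOn M (X.basicOpen g)} = ⊤ := by
    rw [← hU.self_le_iSup_basicOpen_iff]
    intro x hx
    obtain ⟨W, hxW, hW⟩ := hM.exists_isFreeOn x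
    obtain ⟨g, hg, hxg⟩ := hU.exists_basicOpen_le ⟨x, hxW⟩ hx
    exact TopologicalSpace.Opens.mem_iSup.mpr ⟨⟨g, hW.of_le hg⟩, hxg⟩
  obtain ⟨s, hs, hspan⟩ := (Ideal.span_eq_top_iff_finite _).mp hcov
  have hsup : U ≤ ⨆ i : s, X.basicOpen i.1 := (hU.self_le_iSup_basicOpen_iff (s := s)).mpr hspan
  have hle (i : s) : X.basicOpen i.1 ≤ U := X.basicOpen_le _
  have hfree (i : s) : IsFreeOn M (X.basicOpen i.1) := hs i.2
  have haff (i : s) : IsAffineOpen (X.basicOpen i.1) := hU.basicOpen _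
  have haff' (i j : s) : IsAffineOpen (X.basicOpen i.1 ⊓ X.basicOpen j.1) := by
    rw [← X.basicOpen_mul]
    exact hU.basicOpen _
  let _ (i : s) : Algebra Γ(X, U) Γ(X, X.basicOpen i.1) := (resRing X (hle i)).toAlgebra
  let _ (i : s) : Module Γ(X, U) Γ(M, X.basicOpen i.1) := Module.compHom _ (resRing X (hle i))
  have hsmul (i : s) (a : Γ(X, U)) (t : Γ(M, X.basicOpen i.1)) :
    a • t = resRing X (hle i) a • t := rfl
  have _ (i : s) : IsScalarTower Γ(X, U) Γ(X, X.basicOpen i.1) Γ(M, X.basicOpen i.1) :=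
    .of_algebraMap_smul fun _ _ ↦ rfl
  let ρ (i : s) : Γ(M, U) →ₗ[Γ(X, U)] Γ(M, X.basicOpen i.1) :=
    { toFun := resSec M (hle i)
      map_add' := map_add _
      map_smul' := resSec_smul (hle i) }
  have _ (i : s) : IsLocalizedModule.Away i.1 (ρ i) := by
    refine ⟨fun ⟨_, n, h⟩ ↦ ?_, fun t ↦ ?_, fun {t₁ t₂} h ↦ ?_⟩
    · subst h
      have hu : IsUnit (resRing X (hle i) (i.1 ^ n)) := by
        rw [map_pow]
        exact (RingedSpace.isUnit_res_basicOpen X.toRingedSpace i.1).pow n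
      have := (hu.map (algebraMap _ (Module.End Γ(X, X.basicOpen i.1) Γ(M, X.basicOpen i.1))))
      rw [Module.End.isUnit_iff] at this ⊢
      exact this
    · obtain ⟨n, t', h⟩ := exists_resSec_eq_pow_smul_of_cover hle hsup haff haff' hfree t
      exact ⟨⟨t', ⟨_, n, rfl⟩⟩, h.symm⟩
    · obtain ⟨n, h⟩ := exists_pow_smul_eq_zero_of_cover hle hsup haff hfree (f := i.1)
        (t := t₁ - t₂) ((map_sub (resSec M (hle i)) t₁ t₂).trans (sub_eq_zero.mpr h))
      refine ⟨⟨_, n, rfl⟩, ?_⟩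
      rw [smul_sub, sub_eq_zero] at h
      exact h
  refine Module.flat_of_isLocalized_span Γ(X, U) Γ(M, U) (s : Set Γ(X, U)) hspan
    (fun i ↦ Γ(M, X.basicOpen i.1)) ρ fun i ↦ ?_
  have : Module.Flat Γ(X, U) Γ(X, X.basicOpen i.1) := resRing_flat hU (haff i) (hle i)
  have := (hfree i).free
  exact Module.Flat.trans Γ(X, U) Γ(X, X.basicOpen i.1) _

end Flat

/-! ### Morphisms of sheaves of modules from charts -/

section ChartMorphisms

variable {X : Scheme.{u}} {M N : X.Modules} {ι : Type v} [Finite ι] {D : ι → X.IdealSheafData}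

lemma isBasis_charts (hD : ∀ i, IsEffectiveCartier (D i)) :
    TopologicalSpace.Opens.IsBasis (Set.range fun U : Chart D ↦ (U.1.1 : X.Opens)) := by
  rw [TopologicalSpace.Opens.isBasis_iff_nbhd]
  intro W x hx
  obtain ⟨V, hxV, hV⟩ := exists_chart hD hx
  exact ⟨_, ⟨V, rfl⟩, hxV, hV⟩

lemma section_ext_charts (hD : ∀ i, IsEffectiveCartier (D i)) {U : X.Opens} {s t : Γ(M, U)}
    (h : ∀ (V : Chart D) (hV : V.1.1 ≤ U), resSec M hV s = resSec M hV t) : s = t :=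
  section_ext fun _ hx ↦
    let ⟨V, hxV, hV⟩ := exists_chart hD hx
    ⟨V.1.1, hV, hxV, h V hV⟩

lemma hom_ext_charts (hD : ∀ i, IsEffectiveCartier (D i)) {f g : M ⟶ N}
    (h : ∀ (U : Chart D) (s : Γ(M, U.1.1)), homSec f U.1.1 s = homSec g U.1.1 s) : f = g := by
  ext U s
  refine section_ext_charts hD fun V hV ↦ ?_
  exact (homSec_resSec f hV s).symm.trans ((h V _).trans (homSec_resSec g hV s))

/-- Charts form a basis, so compatible additive maps extend to the sheaves; linearity over an
arbitrary open is checked on the charts inside it. -/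
lemma exists_hom_of_charts (hD : ∀ i, IsEffectiveCartier (D i))
    (φ : ∀ U : Chart D, Γ(M, U.1.1) →ₗ[Γ(X, U.1.1)] Γ(N, U.1.1))
    (hφ : ∀ (U V : Chart D) (h : V.1.1 ≤ U.1.1) (s : Γ(M, U.1.1)),
      φ V (resSec M h s) = resSec N h (φ U s)) :
    ∃ f : M ⟶ N, ∀ (U : Chart D) (s : Γ(M, U.1.1)), homSec f U.1.1 s = φ U s := by
  let B (U : Chart D) : X.Opens := U.1.1
  let α : (inducedFunctor B).op ⋙ M.presheaf ⟶ (inducedFunctor B).op ⋙ N.presheaf :=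
    { app U := AddCommGrpCat.ofHom (φ U.unop).toAddMonoidHom
      naturality U V i := by
        ext s
        exact hφ U.unop V.unop (leOfHom i.unop.hom) s }
  let β : M.presheaf ⟶ N.presheaf :=
    TopCat.Sheaf.restrictHomEquivHom M.presheaf ⟨N.presheaf, N.isSheaf⟩ (isBasis_charts hD) α
  have hβ (U : Chart D) (s : Γ(M, U.1.1)) : β.app (op U.1.1) s = φ U s :=
    congr($(TopCat.Sheaf.extend_hom_app M.presheaf ⟨N.presheaf, N.isSheaf⟩
      (isBasis_charts hD) α U) s)
  have hres {U V : X.Opens} (h : V ≤ U) (s : Γ(M, U)) :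
      resSec N h (β.app (op U) s) = β.app (op V) (resSec M h s) :=
    congr($(β.naturality (homOfLE h).op) s).symm
  refine ⟨⟨PresheafOfModules.homMk β fun U r s ↦ ?_⟩, hβ⟩
  refine section_ext_charts hD (M := N) fun V hV ↦ ?_
  let r' : Γ(X, U.unop) := r
  let s' : Γ(M, U.unop) := s
  change resSec N hV (β.app _ (r' • s')) = resSec N hV (r' • β.app (op U.unop) s')
  rw [hres, resSec_smul, resSec_smul, hres, hβ, hβ, map_smul]

end ChartMorphisms

/-! ### Linear algebra, monos and epis of connections -/

lemma exists_linearMap_comp_eq {R P N M : Type*} [CommRing R] [AddCommGroup P] [Module R P]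
    [AddCommGroup N] [Module R N] [AddCommGroup M] [Module R M] {a : P →ₗ[R] N}
    (ha : Function.Injective a) {g : M →ₗ[R] N} (hg : ∀ x, ∃ y, a y = g x) :
    ∃ φ : M →ₗ[R] P, ∀ x, a (φ x) = g x := by
  refine ⟨(LinearEquiv.ofInjective a ha).symm.toLinearMap ∘ₗ g.codRestrict (LinearMap.range a) hg,
    fun x ↦ ?_⟩
  exact congrArg Subtype.val ((LinearEquiv.ofInjective a ha).apply_symm_apply _)

lemma lTensor_rTensor_apply {R P N M Q : Type*} [CommRing R] [AddCommGroup P] [Module R P]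
    [AddCommGroup N] [Module R N] [AddCommGroup M] [Module R M] [AddCommGroup Q] [Module R Q]
    (f : P →ₗ[R] N) (g : M →ₗ[R] Q) (x : P ⊗[R] M) :
    g.lTensor N (f.rTensor M x) = f.rTensor Q (g.lTensor P x) := by
  rw [← LinearMap.comp_apply, ← LinearMap.comp_apply, LinearMap.lTensor_comp_rTensor,
    LinearMap.rTensor_comp_lTensor]

lemma range_rid_comp_lTensor_subtype {R M : Type*} [CommRing R] [AddCommGroup M] [Module R M]
    (I : Ideal R) :
    LinearMap.range ((TensorProduct.rid R M).toLinearMap ∘ₗ I.subtype.lTensor M) = I • ⊤ := by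
  apply le_antisymm
  · rintro _ ⟨x, rfl⟩
    induction x using TensorProduct.induction_on with
    | zero => simp
    | tmul m a => simpa using Submodule.smul_mem_smul a.2 (Submodule.mem_top (x := m))
    | add x y hx hy => rw [map_add]; exact add_mem hx hy
  · rw [Submodule.smul_le]
    exact fun a ha m _ ↦ ⟨m ⊗ₜ ⟨a, ha⟩, by simp⟩

section ConLemmas

variable {X : Scheme.{u}} {k : Type u} [Field k] {p : X ⟶ Spec (.of k)}
  {ι : Type v} {D : ι → X.IdealSheafData}

/-- The action of a morphism of connections on sections. -/
noncomputable abbrev Con.Hom.sec {F G : Con p D} (f : F ⟶ G) (U : X.Opens) :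
    Γ(F.bundle, U) →ₗ[Γ(X, U)] Γ(G.bundle, U) :=
  homSec f.map U

lemma Con.Hom.sec_comp {F G H : Con p D} (f : F ⟶ G) (g : G ⟶ H) (U : X.Opens)
    (s : Γ(F.bundle, U)) : sec (f ≫ g) U s = sec g U (sec f U s) :=
  rfl

lemma Con.Hom.residue_sec {F G : Con p D} (f : F ⟶ G) (U : Chart D) (i : ι)
    (s : Γ(F.bundle, U.1.1)) :
    G.conn.residue U i (sec f U.1.1 s) = (sec f U.1.1).rTensor _ (F.conn.residue U i s) := by
  exact (congrArg _ (Con.Hom.compat f U s)).trans (lTensor_rTensor_apply _ _ _)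

lemma Con.flat (F : Con p D) (U : X.affineOpens) : Module.Flat Γ(X, U.1) Γ(F.bundle, U.1) :=
  F.isVectorBundle.flat U.2

lemma Con.isSMulRegular (F : Con p D) (U : X.affineOpens) {f : Γ(X, U.1)}
    (hf : f ∈ nonZeroDivisors Γ(X, U.1)) : IsSMulRegular Γ(F.bundle, U.1) f :=
  have := F.flat U
  Module.Flat.isSMulRegular_of_nonZeroDivisors hf

lemma Con.hom_ext_charts [Finite ι] (hD : ∀ i, IsEffectiveCartier (D i)) {F G : Con p D}
    {f g : F ⟶ G} (h : ∀ (U : Chart D) (s : Γ(F.bundle, U.1.1)),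
      Con.Hom.sec f U.1.1 s = Con.Hom.sec g U.1.1 s) : f = g :=
  Con.Hom.ext (ParabolicConn.hom_ext_charts hD h)

lemma Con.mono_of_injective [Finite ι] (hD : ∀ i, IsEffectiveCartier (D i)) {F G : Con p D}
    {f : F ⟶ G} (h : ∀ U : Chart D, Function.Injective (Con.Hom.sec f U.1.1)) : Mono f :=
  ⟨fun {_} x y hxy ↦ Con.hom_ext_charts hD fun U s ↦ h U (by
    rw [← Con.Hom.sec_comp, ← Con.Hom.sec_comp, hxy])⟩

/-- Two morphisms out of `G` agreeing on the image of `f` agree on `a · G`, and `a` can be cancelled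
in the flat target. -/
lemma Con.epi_of_exists_smul [Finite ι] (hD : ∀ i, IsEffectiveCartier (D i)) {F G : Con p D}
    {f : F ⟶ G} (h : ∀ U : Chart D, ∃ a ∈ nonZeroDivisors Γ(X, U.1.1),
      ∀ s, ∃ t, Con.Hom.sec f U.1.1 t = a • s) : Epi f :=
  ⟨fun {H} x y hxy ↦ Con.hom_ext_charts hD fun U s ↦ by
    obtain ⟨a, ha, hs⟩ := h U
    obtain ⟨t, ht⟩ := hs s
    refine H.isSMulRegular U.1 ha ?_
    simp only
    rw [← map_smul, ← map_smul, ← ht, ← Con.Hom.sec_comp, ← Con.Hom.sec_comp, hxy]⟩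

end ConLemmas

/-! ### Weights and transition maps of a parabolic connection -/

lemma Weight.exists_le_shift {ι : Type v} {r : ι → ℕ} (hr : ∀ i, r i ≠ 0) (l l' : Weight ι) : ∃ m : ι → ℕ, l' ≤ l.shift r m := by
  refine ⟨fun i ↦ (l' i - l i).toNat, fun i ↦ ?_⟩
  have h1 : (1 : ℤ) ≤ r i := by exact_mod_cast Nat.one_le_iff_ne_zero.mpr (hr i)
  have h2 := Int.self_le_toNat (l' i - l i)
  simp only [Weight.shift]
  nlinarith [Int.natCast_nonneg (l' i - l i).toNat]

lemma Weight.exists_shift_eq_le {ι : Type v} {r : ι → ℕ} (hr : ∀ i, r i ≠ 0)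
    (l l' : Weight ι) :
    ∃ (m : ι → ℕ) (l₀ : Weight ι), l₀.shift r m = l' ∧ l₀ ≤ l := by
  obtain ⟨m, hm⟩ := Weight.exists_le_shift hr l l'
  refine ⟨m, fun i ↦ l' i - r i * m i, funext fun i ↦ sub_add_cancel _ _, fun i ↦ ?_⟩
  have := hm i
  simp only [Weight.shift] at this
  linarith

section ParabolicLemmas

variable {X : Scheme.{u}} {k : Type u} [Field k] {p : X ⟶ Spec (.of k)}
  {ι : Type v} [Fintype ι] {D : ι → X.IdealSheafData} {r : ι → ℕ}

lemma ideal_prod_pow (m : ι → ℕ) (U : X.affineOpens) :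
    (∏ i, D i ^ m i : X.IdealSheafData).ideal U = ∏ i, (D i).ideal U ^ m i := by
  let ev : X.IdealSheafData →* Ideal Γ(X, U.1) :=
    { toFun I := I.ideal U, map_one' := Ideal.one_eq_top.symm, map_mul' _ _ := rfl }
  change ev _ = _
  rw [map_prod]
  rfl

/-- A function on a chart which is a local equation of `∑ i, m i • D i`, is not a zero divisor and
is regular on the logarithmic differentials. -/
lemma IsLogSmooth.exists_equation [PerfectField k] (hD : IsLogSmooth p D) (m : ι → ℕ)
    (U : Chart D) :
    ∃ f ∈ nonZeroDivisors Γ(X, U.1.1), (∏ i, D i ^ m i : X.IdealSheafData).ideal U.1 =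
      Ideal.span {f} ∧ IsSMulRegular (LogForms p D U) f := by
  choose g hg using fun i ↦ (U.2 i).principal
  replace hg (i : ι) : Ideal.span {g i} = (D i).ideal U.1 := (hg i).symm
  refine ⟨∏ i, g i ^ m i, prod_mem fun i _ ↦ pow_mem (hD.mem_nonZeroDivisors (hg i)) _, ?_, ?_⟩
  · rw [ideal_prod_pow, ← Ideal.prod_span_singleton]
    simp [← Ideal.span_singleton_pow, hg]
  · have (s : Finset ι) : IsSMulRegular (LogForms p D U) (∏ i ∈ s, g i ^ m i) := by
      classical
      induction s using Finset.induction_on with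
      | empty => simp [IsSMulRegular.one]
      | insert i s hi ih =>
        rw [Finset.prod_insert hi]
        exact ((hD.isSMulRegular U (hg i)).pow _).mul ih
    exact this _

namespace ParabolicConnection

variable (E E' : ParabolicConnection p D r)

/-- The object of a parabolic connection at a weight. -/
noncomputable abbrev obj (l : Weight ι) : Con p D := E.toFunctor.obj (op l)

/-- The transition maps of a parabolic connection. -/
noncomputable abbrev trans {l l' : Weight ι} (h : l ≤ l') : E.obj l' ⟶ E.obj l :=
  E.toFunctor.map (homOfLE h).op

lemma trans_trans {l l' l'' : Weight ι} (h : l ≤ l') (h' : l' ≤ l'') :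
    E.trans h' ≫ E.trans h = E.trans (h.trans h') := by
  rw [trans, trans, ← Functor.map_comp]
  rfl

lemma sec_trans_trans {l l' l'' : Weight ι} (h : l ≤ l') (h' : l' ≤ l'') (U : X.Opens)
    (s : Γ((E.obj l'').bundle, U)) :
    Con.Hom.sec (E.trans h) U (Con.Hom.sec (E.trans h') U s) =
      Con.Hom.sec (E.trans (h.trans h')) U s := by
  rw [← Con.Hom.sec_comp, trans_trans]

lemma range_shift (l : Weight ι) (m : ι → ℕ) (U : X.affineOpens) :
    LinearMap.range (Con.Hom.sec (E.trans (l.le_shift r m)) U.1) =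
      (∏ i, D i ^ m i : X.IdealSheafData).ideal U • ⊤ := by
  obtain ⟨e, he⟩ := E.isParabolicBundle.pseudoPeriodic l m U
  rw [← range_rid_comp_lTensor_subtype]
  ext x
  refine ⟨fun ⟨s, hs⟩ ↦ ⟨e s, (he s).symm.trans hs⟩, fun ⟨y, hy⟩ ↦ ?_⟩
  obtain ⟨s, rfl⟩ := e.surjective y
  exact ⟨s, (he s).trans hy⟩

lemma injective_shift (l : Weight ι) (m : ι → ℕ) (U : X.affineOpens) :
    Function.Injective (Con.Hom.sec (E.trans (l.le_shift r m)) U.1) := by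
  obtain ⟨e, he⟩ := E.isParabolicBundle.pseudoPeriodic l m U
  have := (E.obj l).flat U
  have h1 : Function.Injective ((Submodule.subtype
      ((∏ i, D i ^ m i : X.IdealSheafData).ideal U)).lTensor Γ((E.obj l).bundle, U.1)) :=
    Module.Flat.lTensor_preserves_injective_linearMap _ Subtype.val_injective
  intro s t hst
  refine e.injective (h1 ((TensorProduct.rid _ _).injective ?_))
  exact (he s).symm.trans (hst.trans (he t))

variable {l l' : Weight ι}

/-- Write `l'` as an integral shift of some `l₀ ≤ l`; the composite `E_{l'} → E_l → E_{l₀}` is the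
injective twist map. -/
lemma injective_trans (hr : ∀ i, r i ≠ 0) (h : l ≤ l') (U : X.affineOpens) :
    Function.Injective (Con.Hom.sec (E.trans h) U.1) := by
  obtain ⟨m, l₀, rfl, hl₀⟩ := Weight.exists_shift_eq_le hr l l'
  refine Function.Injective.of_comp (f := Con.Hom.sec (E.trans hl₀) U.1) ?_
  convert E.injective_shift l₀ m U using 1
  ext1 s
  exact E.sec_trans_trans hl₀ h U.1 s

/-- Some integral shift of `l` lies above `l'`, so the map of that shift, with image `f · E_l`,
factors through `E_{l'}`. -/
lemma exists_trans_eq_smul [PerfectField k] (hD : IsLogSmooth p D) (hr : ∀ i, r i ≠ 0)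
    (h : l ≤ l') (U : Chart D) :
    ∃ f ∈ nonZeroDivisors Γ(X, U.1.1), IsSMulRegular (LogForms p D U) f ∧
      ∀ s, ∃ t, Con.Hom.sec (E.trans h) U.1.1 t = f • s := by
  obtain ⟨m, hm⟩ := Weight.exists_le_shift hr l l'
  obtain ⟨f, hf, hfm, hf'⟩ := hD.exists_equation m U
  refine ⟨f, hf, hf', fun s ↦ ?_⟩
  have h1 : f • s ∈ LinearMap.range (Con.Hom.sec (E.trans (l.le_shift r m)) U.1.1) := by
    rw [range_shift, hfm]
    exact Submodule.smul_mem_smul (Ideal.mem_span_singleton_self f) trivial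
  obtain ⟨t, ht⟩ := h1
  exact ⟨Con.Hom.sec (E.trans hm) U.1.1 t, by rw [sec_trans_trans]; exact ht⟩

lemma mono_trans (hD : IsLogSmooth p D) (hr : ∀ i, r i ≠ 0) (h : l ≤ l') : Mono (E.trans h) :=
  Con.mono_of_injective hD.cartier fun U ↦ E.injective_trans hr h U.1

lemma epi_trans [PerfectField k] (hD : IsLogSmooth p D) (hr : ∀ i, r i ≠ 0) (h : l ≤ l') :
    Epi (E.trans h) :=
  Con.epi_of_exists_smul hD.cartier fun U ↦
    let ⟨f, hf, _, hs⟩ := E.exists_trans_eq_smul hD hr h U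
    ⟨f, hf, hs⟩

end ParabolicConnection

end ParabolicLemmas

/-! ### Residues force compatibility with the parabolic filtration -/

lemma eq_zero_of_tmul_one_eq_zero {R Q : Type*} [CommRing R] [AddCommGroup Q] [Module R Q]
    {I : Ideal R} (hI : ∀ a ∈ I, ∀ q : Q, a • q = 0) {q : Q} (hq : q ⊗ₜ[R] (1 : R ⧸ I) = 0) :
    q = 0 := by
  have h1 := congrArg (TensorProduct.tensorQuotEquivQuotSMul Q I) hq
  rw [← map_one (Ideal.Quotient.mk I), TensorProduct.tensorQuotEquivQuotSMul_tmul_mk, map_zero,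
    one_smul, Submodule.Quotient.mk_eq_zero] at h1
  have h2 : I • (⊤ : Submodule R Q) ≤ ⊥ := by
    rw [Submodule.smul_le]
    exact fun a ha q _ ↦ (Submodule.mem_bot R).mpr (hI a ha q)
  exact (Submodule.mem_bot R).mp (h2 h1)

section Extension

variable {X : Scheme.{u}} {k : Type u} [Field k] {p : X ⟶ Spec (.of k)}
  {ι : Type v} {D : ι → X.IdealSheafData}

lemma Weight.next_le_shift [DecidableEq ι] {r : ι → ℕ} (l : Weight ι) {i : ι} (hr : r i ≠ 0) :
    l.next i ≤ l.shift r (Pi.single i 1) := by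
  intro j
  simp only [Weight.next, Weight.shift]
  by_cases hj : j = i
  · subst hj
    simpa using Nat.one_le_iff_ne_zero.mpr hr
  · simp [hj]

lemma isUnit_scalar (U : X.Opens) {c : k} (hc : c ≠ 0) : IsUnit (scalar p U c) :=
  (IsUnit.mk0 c hc).map _

lemma div_ne_div {ι : Type*} {r : ι → ℕ}
    (hinj : ∀ i, Set.InjOn (fun l : ℕ ↦ (l : k) / (r i : k)) (Set.Iio (r i))) (i : ι) {a b : ℤ}
    (hab : b < a) (ha : a < b + r i) : (a : k) / (r i : k) ≠ (b : k) / (r i : k) := by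
  obtain ⟨n, rfl⟩ : ∃ n : ℕ, a = b + n := ⟨(a - b).toNat, by omega⟩
  intro h
  have h0 : (n : k) / (r i : k) = ((0 : ℕ) : k) / (r i : k) := by
    push_cast at h ⊢
    rw [add_div] at h
    simpa using h
  have := hinj i (show n ∈ Set.Iio (r i) by simp; omega) (show 0 ∈ Set.Iio (r i) by simp; omega) h0
  omega

variable [Fintype ι] {r : ι → ℕ}

namespace ParabolicConnection

variable {E E' : ParabolicConnection p D r}

lemma smul_mem_subBundle (E : ParabolicConnection p D r) (hr : ∀ i, r i ≠ 0) (l : Weight ι) (i : ι)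
    (U : X.affineOpens) {a : Γ(X, U.1)} (ha : a ∈ (D i).ideal U) (s : Γ((E.obj l).bundle, U.1)) :
    a • s ∈ E.subBundle l i U.1 := by
  classical
  have h1 : a • s ∈
      LinearMap.range (Con.Hom.sec (E.trans (l.le_shift r (Pi.single i 1))) U.1) := by
    rw [range_shift, ideal_prod_pow, Fintype.prod_eq_single i (by simp +contextual)]
    simpa using Submodule.smul_mem_smul ha (Submodule.mem_top (x := s))
  obtain ⟨t, ht⟩ := h1
  refine ⟨Con.Hom.sec (E.trans (l.next_le_shift (hr i))) U.1 t, ?_⟩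
  exact (E.sec_trans_trans _ _ _ t).trans ht

/-- The map induced by `g` from `E_w / E_{w+e_i}` to `E'_l / E'_{l+e_i}` intertwines the residues,
which are two different scalars; hence it vanishes. -/
lemma residue_step (hr : ∀ i, r i ≠ 0) (hE : E.IsStrong) (hE' : E'.IsStrong) {l w : Weight ι}
    {i : ι} (hc : (w i : k) / (r i : k) ≠ (l i : k) / (r i : k)) (g : E.obj w ⟶ E'.obj l)
    (U : Chart D)
    (hg : ∀ s, Con.Hom.sec g U.1.1 (Con.Hom.sec (E.trans (w.le_next i)) U.1.1 s) ∈
      E'.subBundle l i U.1.1) (s : Γ((E.obj w).bundle, U.1.1)) :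
    Con.Hom.sec g U.1.1 s ∈ E'.subBundle l i U.1.1 := by
  let S := E'.subBundle l i U.1.1
  let θ := S.mkQ ∘ₗ Con.Hom.sec g U.1.1
  have hθ : E.subBundle w i U.1.1 ≤ LinearMap.ker θ := by
    rintro _ ⟨t, rfl⟩
    exact (Submodule.Quotient.mk_eq_zero S).mpr (hg t)
  let θ' := (E.subBundle w i U.1.1).liftQ θ hθ
  have hθ' : θ' ∘ₗ (E.subBundle w i U.1.1).mkQ = θ := Submodule.liftQ_mkQ _ _ _
  have h1 : θ.rTensor _ ((E.obj w).conn.residue U i s) =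
      (scalar p U.1.1 ((w i : k) / (r i : k)) • θ s) ⊗ₜ 1 := by
    have := congrArg (θ'.rTensor _) (hE w i U s)
    rw [← LinearMap.rTensor_comp_apply, hθ', LinearMap.rTensor_tmul, map_smul] at this
    exact this
  have h2 : θ.rTensor _ ((E.obj w).conn.residue U i s) =
      (scalar p U.1.1 ((l i : k) / (r i : k)) • θ s) ⊗ₜ 1 := by
    rw [LinearMap.rTensor_comp_apply, ← Con.Hom.residue_sec]
    exact hE' l i U _
  have h3 : (scalar p U.1.1 ((w i : k) / (r i : k) - (l i : k) / (r i : k)) • θ s) ⊗ₜ[Γ(X, U.1.1)]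
      (1 : Γ(X, U.1.1) ⧸ (D i).ideal U.1) = 0 := by
    rw [map_sub, sub_smul, TensorProduct.sub_tmul, ← h1, ← h2, sub_self]
  have h4 := eq_zero_of_tmul_one_eq_zero (fun a ha q ↦ ?_) h3
  · rw [(isUnit_scalar U.1.1 (sub_ne_zero.mpr hc)).smul_eq_zero] at h4
    exact (Submodule.Quotient.mk_eq_zero S).mp h4
  · obtain ⟨q, rfl⟩ := S.mkQ_surjective q
    rw [← map_smul]
    exact (Submodule.Quotient.mk_eq_zero S).mpr (E'.smul_mem_subBundle hr l i U.1 ha q)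

/-- Here `n` is the distance of `w` below the full twist `l + r_i e_i`. The bound `n < r i` keeps `w
i > l i`, so that the residue scalars at `w` and `l` differ at each inductive step. -/
lemma sec_trans_mem_subBundle (hr : ∀ i, (r i : k) ≠ 0)
    (hinj : ∀ i, Set.InjOn (fun l : ℕ ↦ (l : k) / (r i : k)) (Set.Iio (r i)))
    (hE : E.IsStrong) (hE' : E'.IsStrong) {l : Weight ι} {i : ι} (ψ : E.obj l ⟶ E'.obj l)
    (U : Chart D) (n : ℕ) {w : Weight ι} (hlw : l ≤ w) (hw : ∀ j, j ≠ i → w j = l j)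
    (hwi : w i + n = l i + r i) (hn : n < r i) (s : Γ((E.obj w).bundle, U.1.1)) :
    Con.Hom.sec ψ U.1.1 (Con.Hom.sec (E.trans hlw) U.1.1 s) ∈ E'.subBundle l i U.1.1 := by
  classical
  have hr' (i : ι) : r i ≠ 0 := fun h ↦ hr i (by rw [h, Nat.cast_zero])
  induction n generalizing w with
  | zero =>
    obtain rfl : w = l.shift r (Pi.single i 1) := by
      funext j
      by_cases hj : j = i
      · subst hj; simpa [Weight.shift] using hwi
      · simpa [Weight.shift, hj] using hw j hj
    have h1 : Con.Hom.sec (E.trans hlw) U.1.1 s ∈ (D i).ideal U.1 • (⊤ : Submodule Γ(X, U.1.1) _) := by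
      have h2 := E.range_shift l (Pi.single i 1) U.1
      rw [ideal_prod_pow, Fintype.prod_eq_single i (by simp +contextual)] at h2
      simp only [Pi.single_eq_same, pow_one] at h2
      rw [← h2]
      exact ⟨s, rfl⟩
    refine Submodule.smul_induction_on h1 (fun a ha m _ ↦ ?_) fun x y hx hy ↦ ?_
    · rw [map_smul]
      exact E'.smul_mem_subBundle hr' l i U.1 ha _
    · rw [map_add]
      exact add_mem hx hy
  | succ n ih =>
    push_cast at hwi
    rw [← Con.Hom.sec_comp]
    refine residue_step hr' hE hE' (div_ne_div hinj i (by omega) (by omega)) (E.trans hlw ≫ ψ) U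
      (fun t ↦ ?_) s
    rw [Con.Hom.sec_comp, sec_trans_trans]
    refine ih (hlw.trans (w.le_next i)) (fun j hj ↦ ?_) ?_ (by omega) t
    · simp [Weight.next, hj, hw j hj]
    · simp only [Weight.next, if_true]
      omega

end ParabolicConnection

end Extension

/-! ### Extending a horizontal morphism to a neighbouring weight -/

section Steps

variable {X : Scheme.{u}} {k : Type u} [Field k] {p : X ⟶ Spec (.of k)}
  {ι : Type v} {D : ι → X.IdealSheafData}

/-- Multiplication by `f` on `N` factors as `a ∘ b`, whence `b ∘ a = f` on `P`. After tensoring, `f`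
is still injective on `P ⊗ Q`, and so is `a`. -/
lemma injective_rTensor_of_smul {R P N Q : Type*} [CommRing R] [AddCommGroup P] [Module R P]
    [AddCommGroup N] [Module R N] [AddCommGroup Q] [Module R Q] [Module.Flat R P] {a : P →ₗ[R] N}
    (ha : Function.Injective a) {f : R} (hf : IsSMulRegular Q f) (h : ∀ s, ∃ t, a t = f • s) :
    Function.Injective (a.rTensor Q) := by
  obtain ⟨b, hb⟩ := exists_linearMap_comp_eq ha (g := f • LinearMap.id) h
  have hba : b ∘ₗ a = f • LinearMap.id := by
    ext t
    apply ha
    simp [hb]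
  refine Function.Injective.of_comp (f := b.rTensor Q) ?_
  have : b.rTensor Q ∘ a.rTensor Q = fun x ↦ f • x := by
    rw [← LinearMap.coe_comp, ← LinearMap.rTensor_comp, hba, LinearMap.rTensor_smul,
      LinearMap.rTensor_id]
    rfl
  rw [this]
  exact hf.lTensor P

lemma rTensor_rTensor_of_comp_eq {R P N M Q : Type*} [CommSemiring R] [AddCommMonoid P] [Module R P]
    [AddCommMonoid N] [Module R N] [AddCommMonoid M] [Module R M] [AddCommMonoid Q] [Module R Q]
    {f : P →ₗ[R] N} {g : N →ₗ[R] M} {h : P →ₗ[R] M} (H : ∀ t, g (f t) = h t) (x : P ⊗[R] Q) :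
    g.rTensor Q (f.rTensor Q x) = h.rTensor Q x := by
  obtain rfl : g ∘ₗ f = h := LinearMap.ext H
  rw [LinearMap.rTensor_comp_apply]

lemma rTensor_smul_add_tmul {R P N Q : Type*} [CommSemiring R] [AddCommMonoid P] [Module R P]
    [AddCommMonoid N] [Module R N] [AddCommMonoid Q] [Module R Q] (f : P →ₗ[R] N) (c : R)
    (x : P ⊗[R] Q) (s : P) (q : Q) :
    f.rTensor Q (c • x + s ⊗ₜ q) = c • f.rTensor Q x + f s ⊗ₜ q := by
  simp

lemma Con.Hom.nabla_sec {F G : Con p D} (f : F ⟶ G) (U : Chart D) (s : Γ(F.bundle, U.1.1)) :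
    G.conn.nabla U (sec f U.1.1 s) =
      (sec f U.1.1).rTensor (LogForms p D U) (F.conn.nabla U s) :=
  Con.Hom.compat f U s

/-- A morphism of bundles whose composition with a morphism of connections that is injective on
log forms is a morphism of connections, is a morphism of connections. -/
lemma Con.exists_lift {F G H : Con p D} (g : F ⟶ H) (a : G ⟶ H) (f : F.bundle ⟶ G.bundle)
    (hf : f ≫ a.map = g.map)
    (ha : ∀ U : Chart D,
      Function.Injective ((Con.Hom.sec a U.1.1).rTensor (LogForms p D U))) :
    ∃ χ : F ⟶ G, χ ≫ a = g := by
  have hs (U : X.Opens) (s : Γ(F.bundle, U)) :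
      Con.Hom.sec a U (homSec f U s) = Con.Hom.sec g U s :=
    congr(homSec $hf U s)
  have hcompat (U : Chart D) (s : Γ(F.bundle, U.1.1)) : G.conn.nabla U (homSec f U.1.1 s) =
      (homSec f U.1.1).rTensor (LogForms p D U) (F.conn.nabla U s) := by
    have h1 := rTensor_rTensor_of_comp_eq (Q := LogForms p D U) (hs U.1.1) (F.conn.nabla U s)
    have h2 := Con.Hom.nabla_sec a U (homSec f U.1.1 s)
    have h3 := Con.Hom.nabla_sec g U s
    rw [hs] at h2
    exact ha U ((h2.symm.trans h3).trans h1.symm)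
  exact ⟨⟨f, hcompat⟩, Con.Hom.ext hf⟩

variable [Fintype ι] {r : ι → ℕ}

namespace ParabolicConnection

variable {E E' : ParabolicConnection p D r}

theorem exists_next [PerfectField k] (hD : IsLogSmooth p D) (hr : ∀ i, (r i : k) ≠ 0)
    (hinj : ∀ i, Set.InjOn (fun l : ℕ ↦ (l : k) / (r i : k)) (Set.Iio (r i)))
    (hE : E.IsStrong) (hE' : E'.IsStrong) (l : Weight ι) (i : ι) (ψ : E.obj l ⟶ E'.obj l) :
    ∃ χ : E.obj (l.next i) ⟶ E'.obj (l.next i),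
      χ ≫ E'.trans (l.le_next i) = E.trans (l.le_next i) ≫ ψ := by
  have hr' (i : ι) : r i ≠ 0 := fun h ↦ hr i (by rw [h, Nat.cast_zero])
  have ha (U : Chart D) := E'.injective_trans hr' (l.le_next i) U.1
  have hmem (U : Chart D) (s : Γ((E.obj (l.next i)).bundle, U.1.1)) :
      ∃ t, Con.Hom.sec (E'.trans (l.le_next i)) U.1.1 t =
        Con.Hom.sec (E.trans (l.le_next i) ≫ ψ) U.1.1 s :=
    -- The weight `l + e_i` lies `r i - 1` unit steps below `l + r_i e_i`.
    sec_trans_mem_subBundle hr hinj hE hE' ψ U (r i - 1) (l.le_next i)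
      (fun j hj ↦ by simp [Weight.next, hj])
      (by have := hr' i; simp only [Weight.next, if_true]; omega)
      (by have := hr' i; omega) s
  choose φ hφ using fun U ↦ exists_linearMap_comp_eq (ha U) (hmem U)
  obtain ⟨f, hf⟩ := exists_hom_of_charts hD.cartier φ fun U V h s ↦ ha V (by
    rw [hφ, homSec_resSec, homSec_resSec, hφ])
  refine Con.exists_lift _ _ f (hom_ext_charts hD.cartier fun U s ↦ ?_) fun U ↦ ?_
  · exact (congrArg _ (hf U s)).trans (hφ U s)
  · obtain ⟨a, _, ha', hs⟩ := E'.exists_trans_eq_smul hD hr' (l.le_next i) U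
    have := (E'.obj (l.next i)).flat U.1
    exact injective_rTensor_of_smul (ha U) ha' hs

/-- The map is `ψ = f⁻¹ χ f`: a section `f s` comes from `E_{l+m}`, and its image under `χ` lands in
`f · E'_l`. -/
theorem exists_of_shift [PerfectField k] (hD : IsLogSmooth p D) (l : Weight ι) (m : ι → ℕ)
    (χ : E.obj (l.shift r m) ⟶ E'.obj (l.shift r m)) :
    ∃ ψ : E.obj l ⟶ E'.obj l,
      E.trans (l.le_shift r m) ≫ ψ = χ ≫ E'.trans (l.le_shift r m) := by
  choose f hf hfm hf' using hD.exists_equation m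
  let a (U : Chart D) := Con.Hom.sec (E.trans (l.le_shift r m)) U.1.1
  let g (U : Chart D) := Con.Hom.sec (χ ≫ E'.trans (l.le_shift r m)) U.1.1
  have ha (U : Chart D) : Function.Injective (a U) := E.injective_shift l m U.1
  have hrange (F : ParabolicConnection p D r) (U : Chart D) (s : Γ((F.obj l).bundle, U.1.1)) :
      (∃ t, Con.Hom.sec (F.trans (l.le_shift r m)) U.1.1 t = s) ↔ ∃ s', f U • s' = s := by
    have := F.range_shift l m U.1
    rw [hfm] at this
    rw [← LinearMap.mem_range, this, Submodule.ideal_span_singleton_smul,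
      Submodule.mem_smul_pointwise_iff_exists]
    simp
  have hreg (F : ParabolicConnection p D r) (U : Chart D) :
      IsSMulRegular Γ((F.obj l).bundle, U.1.1) (f U) := (F.obj l).isSMulRegular U.1 (hf U)
  choose b hb using fun U ↦ exists_linearMap_comp_eq (ha U) (g := f U • LinearMap.id)
    fun s ↦ (hrange E U _).mpr ⟨s, rfl⟩
  choose φ hφ using fun U ↦ exists_linearMap_comp_eq
    (a := f U • (LinearMap.id : Γ((E'.obj l).bundle, U.1.1) →ₗ[Γ(X, U.1.1)] _)) (hreg E' U)
    (g := g U ∘ₗ b U) fun s ↦ (hrange E' U _).mp ⟨Con.Hom.sec χ U.1.1 (b U s), rfl⟩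
  have hφa (U : Chart D) (t) : φ U (a U t) = g U t := hreg E' U (by
    refine (hφ U _).trans ?_
    have : b U (a U t) = f U • t := ha U ((hb U _).trans (map_smul (a U) _ _).symm)
    change g U (b U (a U t)) = f U • g U t
    rw [this, map_smul])
  obtain ⟨ψ, hψ⟩ := exists_hom_of_charts hD.cartier φ fun U V h s ↦ by
    have hfV := resRing_mem_nonZeroDivisors U.1.2 V.1.2 h (hf U)
    refine (E'.obj l).isSMulRegular V.1 hfV ?_
    have h1 : resRing X h (f U) • resSec _ h s = a V (resSec _ h (b U s)) := by
      rw [← resSec_smul]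
      exact (congrArg _ (hb U s).symm).trans (homSec_resSec _ h _).symm
    have h2 : f U • φ U s = g U (b U s) := hφ U s
    change resRing X h (f U) • φ V _ = resRing X h (f U) • resSec _ h (φ U s)
    rw [← map_smul, h1, hφa, ← resSec_smul, h2]
    exact homSec_resSec _ h _
  have hcomp (U : Chart D) (t) : homSec ψ U.1.1 (a U t) = g U t := (hψ U _).trans (hφa U t)
  have hcompat (U : Chart D) (s : Γ((E.obj l).bundle, U.1.1)) :
      (E'.obj l).conn.nabla U (homSec ψ U.1.1 s) =
        (homSec ψ U.1.1).rTensor (LogForms p D U) ((E.obj l).conn.nabla U s) := by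
    have := (E'.obj l).flat U.1
    -- It suffices to compare after multiplying by `f`. Compatibility is known on `f s`, which comes
    -- from `E_{l+m}`; expanding both sides by Leibniz, the `df` terms cancel.
    refine (hf' U).lTensor Γ((E'.obj l).bundle, U.1.1) ?_
    have h1 : (E'.obj l).conn.nabla U (homSec ψ U.1.1 (f U • s)) =
        (homSec ψ U.1.1).rTensor (LogForms p D U) ((E.obj l).conn.nabla U (f U • s)) := by
      have hbs : f U • s = a U (b U s) := (hb U s).symm
      have h2 := rTensor_rTensor_of_comp_eq (Q := LogForms p D U) (hcomp U)
        ((E.obj (l.shift r m)).conn.nabla U (b U s))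
      have h3 := Con.Hom.nabla_sec (E.trans (l.le_shift r m)) U (b U s)
      have h4 := Con.Hom.nabla_sec (χ ≫ E'.trans (l.le_shift r m)) U (b U s)
      rw [hbs, hcomp]
      exact (h4.trans h2.symm).trans (congrArg _ h3.symm)
    have h2 := (E'.obj l).conn.leibniz U (f U) (homSec ψ U.1.1 s)
    have h3 := congrArg ((homSec ψ U.1.1).rTensor (LogForms p D U))
      ((E.obj l).conn.leibniz U (f U) s)
    have h4 : homSec ψ U.1.1 (f U • s) = f U • homSec ψ U.1.1 s := map_smul _ _ _
    have h5 : ((homSec ψ U.1.1).rTensor (LogForms p D U))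
        (f U • (E.obj l).conn.nabla U s + s ⊗ₜ LogForms.d p D U (f U)) =
        f U • (homSec ψ U.1.1).rTensor (LogForms p D U) ((E.obj l).conn.nabla U s) +
          homSec ψ U.1.1 s ⊗ₜ LogForms.d p D U (f U) :=
      rTensor_smul_add_tmul (Q := LogForms p D U) _ _ _ _ _
    have h6 := congrArg ((E'.obj l).conn.nabla U) h4
    have h7 := h2.symm.trans (h6.symm.trans (h1.trans (h3.trans h5)))
    exact add_right_cancel h7
  exact ⟨⟨ψ, hcompat⟩, Con.hom_ext_charts hD.cartier hcomp⟩

end ParabolicConnection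

end Steps

/-! ### Assembling the natural transformation -/

section Rigidity

variable {X : Scheme.{u}} {k : Type u} [Field k] {p : X ⟶ Spec (.of k)}
  {ι : Type v} [Fintype ι] {D : ι → X.IdealSheafData} {r : ι → ℕ}

namespace ParabolicConnection

variable {E E' : ParabolicConnection p D r}

/-- Climb from `0` to `l` in `∑ l i` unit steps, each provided by `exists_next`. -/
theorem exists_of_nonneg [PerfectField k] (hD : IsLogSmooth p D) (hr : ∀ i, (r i : k) ≠ 0)
    (hinj : ∀ i, Set.InjOn (fun l : ℕ ↦ (l : k) / (r i : k)) (Set.Iio (r i)))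
    (hE : E.IsStrong) (hE' : E'.IsStrong) (φ : E.obj 0 ⟶ E'.obj 0) {l : Weight ι} (hl : 0 ≤ l) :
    ∃ χ : E.obj l ⟶ E'.obj l, χ ≫ E'.trans hl = E.trans hl ≫ φ := by
  obtain ⟨n, hn⟩ : ∃ n : ℕ, ∑ i, l i = n :=
    ⟨(∑ i, l i).toNat, (Int.toNat_of_nonneg (Finset.sum_nonneg fun i _ ↦ hl i)).symm⟩
  induction n generalizing l with
  | zero =>
    obtain rfl : l = 0 := funext fun i ↦
      (Finset.sum_eq_zero_iff_of_nonneg fun i _ ↦ hl i).mp (by simpa using hn) i (Finset.mem_univ i)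
    exact ⟨φ, by
      have h (F : ParabolicConnection p D r) : F.trans hl = 𝟙 _ := F.toFunctor.map_id _
      rw [h, h, Category.comp_id, Category.id_comp]⟩
  | succ n ih =>
    obtain ⟨i, -, hi⟩ : ∃ i ∈ Finset.univ, 0 < l i := by
      refine Finset.exists_lt_of_sum_lt (f := fun _ ↦ (0 : ℤ)) ?_
      rw [hn, Finset.sum_const_zero]
      positivity
    classical
    obtain ⟨l', hl', rfl⟩ : ∃ l' : Weight ι, 0 ≤ l' ∧ l'.next i = l := by
      refine ⟨fun j ↦ l j - if j = i then 1 else 0, fun j ↦ ?_, funext fun j ↦ ?_⟩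
      · by_cases hj : j = i
        · subst hj
          simp only [if_true]
          exact Int.le_sub_one_of_lt hi
        · simpa [hj] using hl j
      · by_cases hj : j = i <;> simp [Weight.next, hj]
    obtain ⟨ψ, hψ⟩ := ih hl' (by
      have h : ∑ j, l'.next i j = ∑ j, (l' j + if j = i then (1 : ℤ) else 0) :=
        Finset.sum_congr rfl fun j _ ↦ by by_cases hj : j = i <;> simp [Weight.next, hj]
      have h' : ∑ j, (l' j + if j = i then (1 : ℤ) else 0) = ∑ j, l' j + 1 :=
        Finset.sum_add_distrib.trans (by simp)
      rw [h, h'] at hn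
      push_cast at hn
      linarith)
    obtain ⟨χ, hχ⟩ := exists_next hD hr hinj hE hE' l' i ψ
    refine ⟨χ, ?_⟩
    rw [← E'.trans_trans hl' (l'.le_next i), ← E.trans_trans hl' (l'.le_next i), ← Category.assoc,
      hχ, Category.assoc, hψ, Category.assoc]

theorem hom_ext_of_zero [PerfectField k] (hD : IsLogSmooth p D) (hr : ∀ i, r i ≠ 0)
    {Φ Ψ : E.toFunctor ⟶ E'.toFunctor}
    (h : Φ.app (op (0 : Weight ι)) = Ψ.app (op (0 : Weight ι))) : Φ = Ψ := by
  ext l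
  obtain ⟨m, hm⟩ := Weight.exists_le_shift hr l.unop 0
  have := E'.mono_trans hD hr hm
  have := E.epi_trans hD hr (l.unop.le_shift r m)
  have h1 : Φ.app (op (l.unop.shift r m)) = Ψ.app (op (l.unop.shift r m)) := by
    rw [← cancel_mono (E'.trans hm), ← Φ.naturality, ← Ψ.naturality, h]
  have h2 : E.trans (l.unop.le_shift r m) ≫ Φ.app (op l.unop) =
      E.trans (l.unop.le_shift r m) ≫ Ψ.app (op l.unop) := by
    rw [Φ.naturality, Ψ.naturality, h1]
  exact (cancel_epi _).mp h2

theorem exists_natTrans [PerfectField k] (hD : IsLogSmooth p D) (hr : ∀ i, (r i : k) ≠ 0)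
    (hinj : ∀ i, Set.InjOn (fun l : ℕ ↦ (l : k) / (r i : k)) (Set.Iio (r i)))
    (hE : E.IsStrong) (hE' : E'.IsStrong) (φ : E.obj 0 ⟶ E'.obj 0) :
    ∃ Φ : E.toFunctor ⟶ E'.toFunctor, Φ.app (op (0 : Weight ι)) = φ := by
  have hr' (i : ι) : r i ≠ 0 := fun h ↦ hr i (by rw [h, Nat.cast_zero])
  have hex (l : Weight ι) : ∃ (ψ : E.obj l ⟶ E'.obj l) (w : Weight ι) (h0 : 0 ≤ w) (hl : l ≤ w)
      (χ : E.obj w ⟶ E'.obj w), χ ≫ E'.trans h0 = E.trans h0 ≫ φ ∧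
        E.trans hl ≫ ψ = χ ≫ E'.trans hl := by
    obtain ⟨m, hm⟩ := Weight.exists_le_shift hr' l 0
    obtain ⟨χ, hχ⟩ := exists_of_nonneg hD hr hinj hE hE' φ hm
    obtain ⟨ψ, hψ⟩ := exists_of_shift hD l m χ
    exact ⟨ψ, _, hm, l.le_shift r m, χ, hχ, hψ⟩
  choose ψ w h0 hl χ hχ hψ using hex
  -- The choice of `w l` is immaterial: `ψ l` is compatible with every lift of `φ` at a weight above
  -- `w l`. Naturality is then tested on a common upper bound `v`, whose transition map to `l'` is
  -- epi.
  have key (l v : Weight ι) (hv : w l ≤ v) (ξ : E.obj v ⟶ E'.obj v)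
      (hξ : ξ ≫ E'.trans ((h0 l).trans hv) = E.trans ((h0 l).trans hv) ≫ φ) :
      E.trans ((hl l).trans hv) ≫ ψ l = ξ ≫ E'.trans ((hl l).trans hv) := by
    have := E'.mono_trans hD hr' (h0 l)
    have h1 : ξ ≫ E'.trans hv = E.trans hv ≫ χ l := by
      rw [← cancel_mono (E'.trans (h0 l)), Category.assoc, Category.assoc, hχ, trans_trans, hξ,
        ← Category.assoc, trans_trans]
    rw [← E.trans_trans (hl l) hv, Category.assoc, hψ, ← Category.assoc, ← h1, Category.assoc,
      trans_trans]
  have nat (l l' : Weight ι) (h : l ≤ l') : E.trans h ≫ ψ l = ψ l' ≫ E'.trans h := by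
    let v : Weight ι := fun i ↦ max (w l i) (w l' i)
    have hv : w l ≤ v := fun i ↦ le_max_left _ _
    have hv' : w l' ≤ v := fun i ↦ le_max_right _ _
    obtain ⟨ξ, hξ⟩ := exists_of_nonneg hD hr hinj hE hE' φ ((h0 l).trans hv)
    have := E.epi_trans hD hr' ((hl l').trans hv')
    rw [← cancel_epi (E.trans ((hl l').trans hv')), ← Category.assoc, trans_trans,
      key l v hv ξ hξ, ← Category.assoc, key l' v hv' ξ hξ, Category.assoc, trans_trans]
  refine ⟨{ app := fun l ↦ ψ l.unop, naturality := fun l l' f ↦ nat _ _ (leOfHom f.unop) }, ?_⟩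
  have := E.epi_trans hD hr' (hl 0)
  exact (cancel_epi (E.trans (hl 0))).mp ((hψ 0).trans (hχ 0))

theorem existsUnique_hom [PerfectField k] (hD : IsLogSmooth p D) (hr : ∀ i, (r i : k) ≠ 0)
    (hinj : ∀ i, Set.InjOn (fun l : ℕ ↦ (l : k) / (r i : k)) (Set.Iio (r i)))
    (hE : E.IsStrong) (hE' : E'.IsStrong) (φ : (eval r 0).obj E ⟶ (eval r 0).obj E') :
    ∃! Φ : E ⟶ E', (eval r 0).map Φ = φ := by
  obtain ⟨τ, hτ⟩ := exists_natTrans hD hr hinj hE hE' φ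
  refine ⟨(fullyFaithfulInducedFunctor toFunctor).preimage τ, hτ, fun Ψ hΨ ↦ ?_⟩
  refine (fullyFaithfulInducedFunctor toFunctor).map_injective ?_
  exact hom_ext_of_zero hD (fun i h ↦ hr i (by rw [h, Nat.cast_zero])) (hΨ.trans hτ.symm)

end ParabolicConnection

end Rigidity

end ParabolicConn

theorem mainTheorem6 {k : Type u} [Field k] [PerfectField k] {X : Scheme.{u}}
    (p : X ⟶ Spec (.of k)) {ι : Type v} [Fintype ι] (D : ι → X.IdealSheafData)
    (hD : ParabolicConn.IsLogSmooth p D) (r : ι → ℕ) (hr : ∀ i, (r i : k) ≠ 0)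
    (hinj : ∀ i, Set.InjOn (fun l : ℕ ↦ (l : k) / (r i : k)) (Set.Iio (r i)))
    (E E' : ParabolicConn.ParabolicConnection p D r) (hE : E.IsStrong) (hE' : E'.IsStrong)
    (φ : (ParabolicConn.ParabolicConnection.eval r 0).obj E ≅
      (ParabolicConn.ParabolicConnection.eval r 0).obj E') :
    ∃! Φ : E ≅ E', (ParabolicConn.ParabolicConnection.eval r 0).mapIso Φ = φ := by
  open ParabolicConn.ParabolicConnection in
  obtain ⟨Φ, hΦ, huniq⟩ := existsUnique_hom hD hr hinj hE hE' φ.hom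
  obtain ⟨Ψ, hΨ, -⟩ := existsUnique_hom hD hr hinj hE' hE φ.inv
  refine ⟨⟨Φ, Ψ, ?_, ?_⟩, Iso.ext hΦ, fun Φ' h ↦ Iso.ext (huniq _ congr(($h).hom))⟩
  -- The composite and the identity both extend the identity at weight `0`, so they coincide.
  · refine (existsUnique_hom hD hr hinj hE hE (𝟙 _)).unique ?_ (CategoryTheory.Functor.map_id _ _)
    rw [CategoryTheory.Functor.map_comp, hΦ, hΨ, φ.hom_inv_id]
  · refine (existsUnique_hom hD hr hinj hE' hE' (𝟙 _)).unique ?_ (CategoryTheory.Functor.map_id _ _)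
    rw [CategoryTheory.Functor.map_comp, hΦ, hΨ, φ.inv_hom_id]
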